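/- Let $p_1>\cdots>p_l$ ($l\ge 1$) be odd primes with $p_i=2p_{i+1}+1$ for $1\le i<l$ (a Cunningham chain), let $n=p_1\cdots p_l$, and write $p_l-1=2^xs$ with $s$ odd. Let $N$ be a cyclic group of order $n$, and for $1\le i\le l$ let $\sigma_i\in N$ be an element of order $p_i$. Let $\mathrm{Hol}(N)=N\rtimes\mathrm{Aut}(N)$ with elements $[\eta,\alpha]$ and product $[\eta,\alpha][\mu,\beta]=[\eta\,\alpha(\mu),\alpha\beta]$, acting on $N$ by $[\eta,\alpha]\cdot\mu=\eta\,\alpha(\mu)$; write $\eta$ for $[\eta,\mathrm{id}]$ and $\alpha$ for $[1,\alpha]$. Let $\alpha_i,\beta_i\in\mathrm{Aut}(\langle\sigma_i\rangle)$, extended to $N$ by fixing every $\sigma_j$ with $j\ne i$, have orders $p_{i+1}$ and $2$ respectively for $i<l$, and orders $s$ and $2^x$ respectively for $i=l$. For a set $I\subseteq\{2,\dots,l\}$ containing no two consecutive integers and a tuple $\mathbf t=(t_i)_{i\in I}$ with $1\le t_i\le p_i-1$, put $$J_{I,\mathbf t}=\bigl\langle \sigma_j,\ [\sigma_i,\alpha_{i-1}^{t_i}]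 \;\bigm|\; i\in I,\ j\in\{1,\dots,l\}\setminus I\bigr\rangle,$$ $$A_I=\bigl\langle \alpha_i,\beta_j \;\bigm|\; 1\le i,j\le l,\ i\notin I,\ i+1\notin I,\ j\notin I\bigr\rangle\le\mathrm{Aut}(N).$$ (1) The subgroups of $\mathrm{Hol}(N)$ that are transitive on $N$ are exactly the (internal) semidirect products $J_{I,\mathbf t}\rtimes A$ with $I,\mathbf t$ as above and $A\le A_I$. (In particular, for all such $I,\mathbf t,A$ the group $A$ normalises $J_{I,\mathbf t}$ and meets it trivially.) (2) Let $\pi$ be the set of primes dividing $n$. Then $H=\langle\sigma_1,\dots,\sigma_l,\alpha_1,\dots,\alpha_{l-1}\rangle$ is normal in $\mathrm{Hol}(N)$ and is its unique Hall $\pi$-subgroup. A subgroup $M\le H$ is transitive on $N$ if and only if it is an internal product $$M=\langle\sigma_1\rangle A_2\cdots A_l$$ (every element of $M$ being uniquely $a_1a_2\cdots a_l$ with $a_1\in\langle\sigma_1\rangle$ and $a_i\in A_i$), where for each $2\le i\le l$ the group $A_i$ is either $\langle[\sigma_i,\alpha_{i-1}^{t_i}]\rangle$ with $0\le t_i\le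 p_i-1$, of order $p_i$, or $\langle\sigma_i,\alpha_{i-1}\rangle$, of order $p_i^2$. For such an $M$ and $2\le i\le l-1$, if both $A_i$ and $A_{i+1}$ have prime order, then $A_i=\langle\sigma_i\rangle$ or $A_{i+1}=\langle\sigma_{i+1}\rangle$. More precisely, given groups $A_2,\dots,A_l$ of the two kinds above, the product $\langle\sigma_1\rangle A_2\cdots A_l$ is a subgroup of $H$ (with unique factorisation as above) if and only if for every $2\le i\le l-1$ one has $A_i=\langle\sigma_i\rangle$, or $A_i=\langle\sigma_i,\alpha_{i-1}\rangle$, or $A_{i+1}=\langle\sigma_{i+1}\rangle$. -/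

import Mathlib

open scoped Pointwise

/-- `p 1 > p 2 > ⋯ > p l` is a Cunningham chain of length `l ≥ 1`: the `p i` are odd primes and
`p i = 2 * p (i + 1) + 1` for `1 ≤ i < l`. Values of `p` outside `1, …, l` are irrelevant. -/
structure IsCunninghamChain (l : ℕ) (p : ℕ → ℕ) : Prop where
  one_le : 1 ≤ l
  prime : ∀ i ∈ Finset.Icc 1 l, (p i).Prime
  odd : ∀ i ∈ Finset.Icc 1 l, Odd (p i)
  step : ∀ i, 1 ≤ i → i < l → p i = 2 * p (i + 1) + 1

/-- The holomorph `N ⋊ Aut N`, with `[η, α] * [μ, β] = [η * α μ, α * β]`. -/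
abbrev Hol (N : Type*) [Group N] : Type _ :=
  N ⋊[MonoidHom.id (MulAut N)] MulAut N

namespace Hol

variable {N : Type*} [Group N]

/-- The natural action of the holomorph on `N`: `[η, α]` sends `μ` to `η * α μ`. -/
instance : MulAction (Hol N) N where
  smul g μ := g.left * g.right μ
  one_smul μ := by
    change (1 : Hol N).left * (1 : Hol N).right μ = μ
    simp
  mul_smul g h μ := by
    change (g * h).left * (g * h).right μ = g.left * g.right (h.left * h.right μ)
    simp [mul_assoc]

/-- The element `η` of `N`, regarded as `[η, id]`. -/
abbrev ofN (η : N) : Hol N := SemidirectProduct.inl η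

/-- A subgroup of `Aut N`, regarded as a subgroup of the holomorph. -/
def autSubgroup (A : Subgroup (MulAut N)) : Subgroup (Hol N) :=
  A.map SemidirectProduct.inr

end Hol

/-- `H` is a Hall `π`-subgroup of the finite group `G`: every prime dividing `|H|` lies in `π`, and
no prime of `π` divides the index of `H`. -/
def IsHallSubgroup {G : Type*} [Group G] (π : Finset ℕ) (H : Subgroup G) : Prop :=
  (∀ q : ℕ, q.Prime → q ∣ Nat.card H → q ∈ π) ∧ ∀ q ∈ π, ¬ q ∣ H.index

/-- `M = A 1 * A 2 * ⋯ * A l` as a set, every element of `M` being uniquely of the form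
`a 1 * a 2 * ⋯ * a l` with `a i ∈ A i` (for finite groups: the orders multiply). -/
def IsInternalProduct {G : Type*} [Group G] (l : ℕ) (A : ℕ → Subgroup G) (M : Subgroup G) : Prop :=
  (M : Set G) = ((List.range' 1 l).map fun i => (A i : Set G)).prod ∧
    Nat.card M = ∏ i ∈ Finset.Icc 1 l, Nat.card (A i)

/-- `M = J ⋊ A` internally. -/
structure IsInternalSemidirect {G : Type*} [Group G] (M J A : Subgroup G) : Prop where
  left_le : J ≤ M
  right_le : A ≤ M
  normal : (J.subgroupOf M).Normal
  disjoint : J ⊓ A = ⊥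
  sup_eq : J ⊔ A = M

namespace CyclicHol

variable {N : Type*} [Group N]

/-- For a group `N` of order `p 1 * ⋯ * p l`, where `p l = 2 ^ x * s + 1` with `s` odd: `σ i ∈ N` has
order `p i`; `α i, β i ∈ Aut ⟨σ i⟩` (extended to `N` by fixing the other `σ j`) have orders
`p (i + 1), 2` if `i < l`, and `s, 2 ^ x` if `i = l`. -/
structure IsGeneratorChoice (l : ℕ) (p : ℕ → ℕ) (x s : ℕ)
    (σ : ℕ → N) (α β : ℕ → MulAut N) : Prop where
  orderOf_σ : ∀ i ∈ Finset.Icc 1 l, orderOf (σ i) = p i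
  α_fix : ∀ i ∈ Finset.Icc 1 l, ∀ j ∈ Finset.Icc 1 l, j ≠ i → α i (σ j) = σ j
  β_fix : ∀ i ∈ Finset.Icc 1 l, ∀ j ∈ Finset.Icc 1 l, j ≠ i → β i (σ j) = σ j
  orderOf_α : ∀ i, 1 ≤ i → i < l → orderOf (α i) = p (i + 1)
  orderOf_β : ∀ i, 1 ≤ i → i < l → orderOf (β i) = 2
  orderOf_α_last : orderOf (α l) = s
  orderOf_β_last : orderOf (β l) = 2 ^ x

/-- The subgroup `H = ⟨σ 1, …, σ l, α 1, …, α (l - 1)⟩` of the holomorph. -/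
def hallH (l : ℕ) (σ : ℕ → N) (α : ℕ → MulAut N) : Subgroup (Hol N) :=
  Subgroup.closure
    ({g | ∃ i, 1 ≤ i ∧ i ≤ l ∧ g = Hol.ofN (σ i)} ∪
      {g | ∃ i, 1 ≤ i ∧ i < l ∧ g = SemidirectProduct.inr (α i)})

/-- The element `[σ i, α (i - 1) ^ t]` of the holomorph (used for `2 ≤ i ≤ l`). -/
def twisted (σ : ℕ → N) (α : ℕ → MulAut N) (i t : ℕ) : Hol N :=
  ⟨σ i, α (i - 1) ^ t⟩

/-- The subgroup `⟨σ i, α (i - 1)⟩` of the holomorph (used for `2 ≤ i ≤ l`). -/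
def fullFactor (σ : ℕ → N) (α : ℕ → MulAut N) (i : ℕ) : Subgroup (Hol N) :=
  Subgroup.closure {Hol.ofN (σ i), SemidirectProduct.inr (α (i - 1))}

/-- `A 1 = ⟨σ 1⟩`, and for `2 ≤ i ≤ l` the group `A i` is either `⟨[σ i, α (i - 1) ^ t]⟩` for some
`0 ≤ t ≤ p i - 1`, or `⟨σ i, α (i - 1)⟩`. -/
def IsFactorFamily (l : ℕ) (p : ℕ → ℕ) (σ : ℕ → N) (α : ℕ → MulAut N)
    (A : ℕ → Subgroup (Hol N)) : Prop :=
  A 1 = Subgroup.zpowers (Hol.ofN (σ 1)) ∧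
    ∀ i ∈ Finset.Icc 2 l,
      (∃ t, t ≤ p i - 1 ∧ A i = Subgroup.zpowers (twisted σ α i t)) ∨ A i = fullFactor σ α i

/-- `I ⊆ {2, …, l}` contains no two consecutive integers, and `1 ≤ t i ≤ p i - 1` for `i ∈ I`. -/
def IsIndexData (l : ℕ) (p : ℕ → ℕ) (I : Finset ℕ) (t : ℕ → ℕ) : Prop :=
  I ⊆ Finset.Icc 2 l ∧ (∀ i ∈ I, i + 1 ∉ I) ∧ ∀ i ∈ I, 1 ≤ t i ∧ t i ≤ p i - 1

/-- `J_{I,t} = ⟨σ j, [σ i, α (i - 1) ^ t i] | i ∈ I, j ∈ {1, …, l} ∖ I⟩`. -/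
def J (l : ℕ) (σ : ℕ → N) (α : ℕ → MulAut N) (I : Finset ℕ) (t : ℕ → ℕ) : Subgroup (Hol N) :=
  Subgroup.closure
    ({g | ∃ j ∈ Finset.Icc 1 l \ I, g = Hol.ofN (σ j)} ∪ {g | ∃ i ∈ I, g = twisted σ α i (t i)})

/-- `A_I = ⟨α i, β j | i ∈ S_I, j ∈ {1, …, l} ∖ I⟩`, where `S_I` is the set of `i ∈ {1, …, l}` such
that neither `i` nor `i + 1` lies in `I`. -/
def autI (l : ℕ) (α β : ℕ → MulAut N) (I : Finset ℕ) : Subgroup (MulAut N) :=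
  Subgroup.closure
    ({φ | ∃ i ∈ Finset.Icc 1 l, i ∉ I ∧ i + 1 ∉ I ∧ φ = α i} ∪
      {φ | ∃ j ∈ Finset.Icc 1 l, j ∉ I ∧ φ = β j})

end CyclicHol

/-! `Aut N` is abelian and acts on ⟨σ_i⟩ through a multiplier in (ℤ/p_i)^×, a group of order p_i −
1, which equals 2p_{i+1} for i < l. So p_i divides p_j − 1 only for j = i − 1: for i ≥ 2 the
automorphisms of order p_i lie in ⟨α_{i−1}⟩ and move only σ_{i−1}, and there are none of order p_1.
One exponent e_i (`projExp`) therefore projects N onto ⟨σ_i⟩ and `Aut N` onto ⟨α_{i−1}⟩. Applied to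
each coordinate of [η, φ] separately it gives `comp`, which is neither the power in `Hol N` nor
multiplicative in general. Still, every element of H = N ⋊ ⟨α_1, …, α_{l−1}⟩ is uniquely the product
of its components in increasing order, because the factors before the i-th one fix σ_i.

Two facts about subgroups M carry the rest. Pigeonhole (`exists_tw_mem`): if M is transitive, the
p_i elements of ⟨σ_i⟩ compete for p_i − 1 multipliers, which yields some [σ_i, α_{i−1}^t] in M.
Commutator (`ofN_sigma_mem_of_apply_ne`): if M contains such an element and a suitable one moving
σ_i, then σ_i lies in M. Inside H this means that a cyclic twisted factor at i excludes any
automorphism part at i + 1; `exists_subgroup_of_adjacent` shows that this is the only obstruction to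
a product being a subgroup.

For a general transitive M let I be the set of i with σ_i ∉ M. The commutator argument forbids
consecutive indices in I. The group J lies in M and has exactly one element over each point of N, so
M = J ⋊ (M ∩ `Aut N`). Elements of this complement fix σ_i for i ∈ I, and have no α_{i−1}-part,
since otherwise σ_i would be in M; this bounds the complement by A_I. -/

section Action

variable {N : Type*} [Group N]

theorem apply_eq_self_of_mem_zpowers {σ : N} {φ : MulAut N} (hφ : φ σ = σ) {y : N}
    (hy : y ∈ Subgroup.zpowers σ) : φ y = y := by
  obtain ⟨k, rfl⟩ := hy
  simp only [map_zpow, hφ]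

theorem apply_eq_apply_of_mem_zpowers {σ : N} {φ ψ : MulAut N} (h : φ σ = ψ σ) {y : N}
    (hy : y ∈ Subgroup.zpowers σ) : φ y = ψ y := by
  obtain ⟨k, rfl⟩ := hy
  simp only [map_zpow, h]

end Action

/-! ### Automorphisms of cyclic groups and their multipliers -/

section Cyclic

variable {N : Type*} [Group N] [IsCyclic N]

theorem MulAut.exists_zpow_of_isCyclic (φ : MulAut N) : ∃ k : ℤ, ∀ g, φ g = g ^ k :=
  MonoidHom.map_cyclic φ.toMonoidHom

theorem MulAut.commute_of_isCyclic (φ ψ : MulAut N) : Commute φ ψ := by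
  obtain ⟨k, hk⟩ := φ.exists_zpow_of_isCyclic
  obtain ⟨m, hm⟩ := ψ.exists_zpow_of_isCyclic
  ext g
  simp only [MulAut.mul_apply, hk, hm, ← zpow_mul, mul_comm]

/-- The multiplier of an automorphism of a cyclic group on the element `σ`. -/
noncomputable def multiplier (σ : N) : MulAut N →* ZMod (orderOf σ) where
  toFun φ := (φ.exists_zpow_of_isCyclic.choose : ℤ)
  map_one' := by
    have h := (1 : MulAut N).exists_zpow_of_isCyclic.choose_spec σ
    rw [MulAut.one_apply] at h
    have := (ZMod.intCast_eq_intCast_iff _ _ _).2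
      (zpow_eq_zpow_iff_modEq.1 ((zpow_one σ).trans h))
    exact this.symm.trans Int.cast_one
  map_mul' φ ψ := by
    have h := (φ * ψ).exists_zpow_of_isCyclic.choose_spec σ
    rw [MulAut.mul_apply, φ.exists_zpow_of_isCyclic.choose_spec,
      ψ.exists_zpow_of_isCyclic.choose_spec, ← zpow_mul, mul_comm] at h
    have := (ZMod.intCast_eq_intCast_iff _ _ _).2 (zpow_eq_zpow_iff_modEq.1 h)
    simpa using this.symm

theorem multiplier_eq_iff (σ : N) (φ ψ : MulAut N) :
    multiplier σ φ = multiplier σ ψ ↔ φ σ = ψ σ := by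
  rw [φ.exists_zpow_of_isCyclic.choose_spec, ψ.exists_zpow_of_isCyclic.choose_spec,
    zpow_eq_zpow_iff_modEq]
  exact ZMod.intCast_eq_intCast_iff _ _ _

theorem multiplier_eq_one_iff (σ : N) (φ : MulAut N) : multiplier σ φ = 1 ↔ φ σ = σ := by
  rw [← map_one (multiplier σ), multiplier_eq_iff, MulAut.one_apply]

theorem apply_mem_zpowers (φ : MulAut N) {σ y : N} (hy : y ∈ Subgroup.zpowers σ) :
    φ y ∈ Subgroup.zpowers σ := by
  obtain ⟨k, hk⟩ := φ.exists_zpow_of_isCyclic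
  rw [hk]
  exact Subgroup.zpow_mem _ hy _

/-- Fermat's little theorem, applied to the multiplier. -/
theorem pow_orderOf_sub_one_apply {σ : N} (hσ : (orderOf σ).Prime) (φ : MulAut N) {m : ℕ}
    (hm : orderOf σ - 1 ∣ m) : (φ ^ m) σ = σ := by
  have := Fact.mk hσ
  obtain ⟨c, rfl⟩ := hm
  rw [← multiplier_eq_one_iff, map_pow, pow_mul, ZMod.pow_card_sub_one_eq_one, one_pow]
  exact (IsUnit.map (multiplier σ) (Group.isUnit φ)).ne_zero

/-- Multipliers form a cyclic group: an automorphism whose multiplier is killed by the order of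
`γ` agrees with a power of `γ`, provided the powers of `γ` are determined by their multiplier. -/
theorem exists_pow_apply_eq {σ : N} (hσ : (orderOf σ).Prime) {γ : MulAut N} (hγ : 0 < orderOf γ)
    (hfaith : ∀ m : ℕ, (γ ^ m) σ = σ → γ ^ m = 1) {φ : MulAut N}
    (hφ : (φ ^ orderOf γ) σ = σ) : ∃ k : ℕ, (γ ^ k) σ = φ σ := by
  have := Fact.mk hσ
  -- By faithfulness the multiplier of γ is a primitive root of unity, and in a field its powers
  -- exhaust the roots of unity of that exponent.
  have hprim : IsPrimitiveRoot (multiplier σ γ) (orderOf γ) := by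
    constructor
    · rw [← map_pow, pow_orderOf_eq_one, map_one]
    · intro m hm
      rw [← map_pow, multiplier_eq_one_iff] at hm
      exact orderOf_dvd_of_pow_eq_one (hfaith m hm)
  have : NeZero (orderOf γ) := ⟨hγ.ne'⟩
  obtain ⟨k, -, hk⟩ := hprim.eq_pow_of_pow_eq_one
    (ξ := multiplier σ φ) (by rw [← map_pow, multiplier_eq_one_iff, hφ])
  exact ⟨k, by rw [← multiplier_eq_iff, map_pow, hk]⟩

/-- A finite cyclic group has at most d solutions of a^d = 1, and ⟨σ⟩ already supplies d = `orderOf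
σ` of them. -/
theorem mem_zpowers_of_pow_orderOf_eq_one [Finite N] {σ y : N} (hy : y ^ orderOf σ = 1) :
    y ∈ Subgroup.zpowers σ := by
  classical
  have := Fintype.ofFinite N
  have hsub : (Finset.univ.filter fun a : N => a ∈ Subgroup.zpowers σ) ⊆
      Finset.univ.filter fun a : N => a ^ orderOf σ = 1 := by
    intro a ha
    simp only [Finset.mem_filter, Finset.mem_univ, true_and] at ha ⊢
    obtain ⟨k, rfl⟩ := ha
    simp only
    rw [← zpow_natCast, ← zpow_mul, mul_comm, zpow_mul, zpow_natCast, pow_orderOf_eq_one, one_zpow]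
  have hcard : (Finset.univ.filter fun a : N => a ∈ Subgroup.zpowers σ).card = orderOf σ := by
    rw [← Nat.card_zpowers, ← Fintype.card_subtype, Nat.card_eq_fintype_card]
  have := Finset.eq_of_subset_of_card_le hsub
    (by rw [hcard]; exact IsCyclic.card_pow_eq_one_le (orderOf_pos σ))
  have hmem : y ∈ Finset.univ.filter fun a : N => a ^ orderOf σ = 1 := by simpa using hy
  rw [← this] at hmem
  simpa using hmem

end Cyclic

/-! ### Exponents that project onto the parts belonging to one prime -/

section ProjectionExponent

/-- An exponent whose power map projects a group of exponent `∏ p i` to its `p i`-part, and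
`Aut N` to the group generated by `α (i - 1)`. -/
def projExp (l : ℕ) (p : ℕ → ℕ) (i : ℕ) : ℕ :=
  ((∏ j ∈ (Finset.Icc 1 l).erase i, p j) *
    (2 * ∏ j ∈ (Finset.Icc 1 l).filter (fun j => j + 1 ≠ i), (p j - 1))) ^ (p i - 1)

variable {l : ℕ} {p : ℕ → ℕ}

namespace IsCunninghamChain

theorem three_le (hp : IsCunninghamChain l p) {i : ℕ} (hi : i ∈ Finset.Icc 1 l) : 3 ≤ p i := by
  have h2 := (hp.prime i hi).two_le
  have := hp.odd i hi
  rcases h2.lt_or_eq with h | h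
  · exact h
  · rw [← h] at this
    exact absurd this (by decide)

theorem lt_of_lt (hp : IsCunninghamChain l p) {i j : ℕ} (hi : 1 ≤ i) (hij : i < j) (hj : j ≤ l) :
    p j < p i := by
  induction j, hij using Nat.le_induction with
  | base =>
    change p (i + 1) < p i
    have := hp.step i hi hj
    omega
  | succ k hk ih =>
    have := hp.step k (by omega) hj
    have := ih (by omega)
    omega

theorem ne_of_ne (hp : IsCunninghamChain l p) {i j : ℕ} (hi : i ∈ Finset.Icc 1 l)
    (hj : j ∈ Finset.Icc 1 l) (hij : i ≠ j) : p i ≠ p j := by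
  rw [Finset.mem_Icc] at hi hj
  rcases lt_or_gt_of_ne hij with h | h
  · exact (hp.lt_of_lt hi.1 h hj.2).ne'
  · exact (hp.lt_of_lt hj.1 h hi.2).ne

theorem last_le (hp : IsCunninghamChain l p) {i : ℕ} (hi : i ∈ Finset.Icc 1 l) : p l ≤ p i := by
  rw [Finset.mem_Icc] at hi
  rcases hi.2.lt_or_eq with h | h
  · exact (hp.lt_of_lt hi.1 h le_rfl).le
  · rw [h]

/-- The only odd prime dividing p_j − 1 = 2p_{j+1} is p_{j+1}, and p_l − 1 is smaller than every
prime of the chain. -/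
theorem not_dvd_sub_one (hp : IsCunninghamChain l p) {i j : ℕ} (hi : i ∈ Finset.Icc 1 l)
    (hj : j ∈ Finset.Icc 1 l) (hij : j + 1 ≠ i) : ¬ p i ∣ p j - 1 := by
  intro hdvd
  have hj' := Finset.mem_Icc.1 hj
  rcases hj'.2.lt_or_eq with h | h
  · have hj1 : j + 1 ∈ Finset.Icc 1 l := Finset.mem_Icc.2 ⟨by omega, h⟩
    rw [hp.step j hj'.1 h, Nat.add_sub_cancel] at hdvd
    rcases (hp.prime i hi).dvd_mul.1 hdvd with h2 | h2
    · have := Nat.le_of_dvd (by norm_num) h2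
      have := hp.three_le hi
      omega
    · exact hp.ne_of_ne hj1 hi hij
        ((Nat.prime_dvd_prime_iff_eq (hp.prime i hi) (hp.prime _ hj1)).1 h2).symm
  · subst h
    have := Nat.le_of_dvd (by have := hp.three_le hj; omega) hdvd
    have := hp.last_le hi
    have := hp.three_le hj
    omega

theorem sub_one_ne_zero (hp : IsCunninghamChain l p) {i : ℕ} (hi : i ∈ Finset.Icc 1 l) :
    p i - 1 ≠ 0 := by
  have := hp.three_le hi
  omega

/-- The base of the power is prime to p_i, because p_{i−1} − 1, the one p_j − 1 divisible by p_i, is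
left out of the product and only its factor 2 is kept. The outer exponent p_i − 1 then gives 1 by
Fermat. -/
theorem projExp_modEq_one (hp : IsCunninghamChain l p) {i : ℕ} (hi : i ∈ Finset.Icc 1 l) :
    projExp l p i ≡ 1 [MOD p i] := by
  have hpi := hp.prime i hi
  rw [projExp, ← Nat.totient_prime hpi]
  refine Nat.ModEq.pow_totient (Nat.Coprime.mul_left ?_ (Nat.Coprime.mul_left ?_ ?_))
  · refine Nat.Coprime.prod_left fun j hj => ?_
    rw [Finset.mem_erase] at hj
    exact (Nat.coprime_primes (hp.prime j hj.2) hpi).2 (hp.ne_of_ne hj.2 hi hj.1)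
  · exact (Nat.coprime_primes Nat.prime_two hpi).2 (by have := hp.three_le hi; omega)
  · refine Nat.Coprime.prod_left fun j hj => ?_
    rw [Finset.mem_filter] at hj
    exact ((hpi.coprime_iff_not_dvd).2 (hp.not_dvd_sub_one hi hj.1 hj.2)).symm

theorem dvd_projExp (hp : IsCunninghamChain l p) {i j : ℕ} (hi : i ∈ Finset.Icc 1 l)
    (hj : j ∈ Finset.Icc 1 l) (hij : j ≠ i) : p j ∣ projExp l p i :=
  ((Finset.dvd_prod_of_mem p (Finset.mem_erase.2 ⟨hij, hj⟩)).mul_right _).trans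
    (dvd_pow_self _ (hp.sub_one_ne_zero hi))

theorem prod_dvd_projExp_mul (hp : IsCunninghamChain l p) {i : ℕ} (hi : i ∈ Finset.Icc 1 l) :
    ∏ j ∈ Finset.Icc 1 l, p j ∣ projExp l p i * p i := by
  rw [← Finset.prod_erase_mul _ _ hi]
  exact Nat.mul_dvd_mul_right ((dvd_mul_right _ _).trans
    (dvd_pow_self _ (hp.sub_one_ne_zero hi))) _

theorem two_dvd_projExp (hp : IsCunninghamChain l p) {i : ℕ} (hi : i ∈ Finset.Icc 1 l) :
    2 ∣ projExp l p i :=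
  ((dvd_mul_right 2 _).mul_left _).trans (dvd_pow_self _ (hp.sub_one_ne_zero hi))

theorem sub_one_dvd_projExp (hp : IsCunninghamChain l p) {i j : ℕ} (hi : i ∈ Finset.Icc 1 l)
    (hj : j ∈ Finset.Icc 1 l) (hij : j + 1 ≠ i) : p j - 1 ∣ projExp l p i :=
  (((Finset.dvd_prod_of_mem (fun j => p j - 1)
    (Finset.mem_filter.2 ⟨hj, hij⟩)).mul_left _).mul_left _).trans
    (dvd_pow_self _ (hp.sub_one_ne_zero hi))

/-- Chinese remainder theorem: modulo n the exponents are orthogonal idempotents, so an element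
killed by n is the product of its projections. -/
theorem sum_projExp_modEq_one (hp : IsCunninghamChain l p) :
    ∑ i ∈ Finset.Icc 1 l, projExp l p i ≡ 1 [MOD ∏ i ∈ Finset.Icc 1 l, p i] := by
  have key : ((∏ i ∈ Finset.Icc 1 l, p i : ℕ) : ℤ) ∣
      (1 : ℕ) - ((∑ i ∈ Finset.Icc 1 l, projExp l p i : ℕ) : ℤ) := by
    rw [Nat.cast_prod]
    refine Finset.prod_dvd_of_coprime ?_ fun j hj => ?_
    · intro i hi j hj hij
      exact Nat.isCoprime_iff_coprime.2
        ((Nat.coprime_primes (hp.prime i hi) (hp.prime j hj)).2 (hp.ne_of_ne hi hj hij))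
    · refine Nat.modEq_iff_dvd.1 ?_
      rw [← Finset.add_sum_erase _ _ hj]
      have h0 : ∑ i ∈ (Finset.Icc 1 l).erase j, projExp l p i ≡ 0 [MOD p j] := by
        refine (Nat.modEq_zero_iff_dvd).2 (Finset.dvd_sum fun i hi => ?_)
        rw [Finset.mem_erase] at hi
        exact hp.dvd_projExp hi.2 hj (Ne.symm hi.1)
      exact (hp.projExp_modEq_one hj).add h0
  exact Nat.modEq_iff_dvd.2 key

variable {G : Type*} [Group G]

theorem pow_projExp_of_pow_eq_one (hp : IsCunninghamChain l p) {i : ℕ} (hi : i ∈ Finset.Icc 1 l)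
    {g : G} (hg : g ^ p i = 1) : g ^ projExp l p i = g := by
  have := pow_eq_pow_of_modEq (hp.projExp_modEq_one hi) hg
  rwa [pow_one] at this

theorem pow_projExp_eq_one (hp : IsCunninghamChain l p) {i j : ℕ} (hi : i ∈ Finset.Icc 1 l)
    (hj : j ∈ Finset.Icc 1 l) (hij : j ≠ i) {g : G} (hg : g ^ p j = 1) :
    g ^ projExp l p i = 1 := by
  obtain ⟨c, hc⟩ := hp.dvd_projExp hi hj hij
  rw [hc, pow_mul, hg, one_pow]

theorem pow_sum_projExp (hp : IsCunninghamChain l p) {g : G}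
    (hg : g ^ ∏ i ∈ Finset.Icc 1 l, p i = 1) :
    g ^ ∑ i ∈ Finset.Icc 1 l, projExp l p i = g := by
  have := pow_eq_pow_of_modEq hp.sum_projExp_modEq_one hg
  rwa [pow_one] at this

theorem mem_of_pow_projExp_mem (hp : IsCunninghamChain l p) {g : G}
    (hg : g ^ ∏ i ∈ Finset.Icc 1 l, p i = 1) {S : Subgroup G}
    (h : ∀ i ∈ Finset.Icc 1 l, g ^ projExp l p i ∈ S) : g ∈ S := by
  rw [← hp.pow_sum_projExp hg]
  refine Finset.sum_induction _ (fun m => g ^ m ∈ S) (fun a b ha hb => ?_) ?_ h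
  · rw [pow_add]; exact S.mul_mem ha hb
  · rw [pow_zero]; exact S.one_mem

theorem eq_of_pow_projExp_eq (hp : IsCunninghamChain l p) {g k : G}
    (hg : g ^ ∏ i ∈ Finset.Icc 1 l, p i = 1) (hk : k ^ ∏ i ∈ Finset.Icc 1 l, p i = 1)
    (h : ∀ i ∈ Finset.Icc 1 l, g ^ projExp l p i = k ^ projExp l p i) : g = k := by
  rw [← hp.pow_sum_projExp hg, ← hp.pow_sum_projExp hk]
  refine Finset.sum_induction _ (fun m => g ^ m = k ^ m) (fun a b ha hb => ?_) ?_ h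
  · rw [pow_add, pow_add, ha, hb]
  · rw [pow_zero, pow_zero]

end IsCunninghamChain

end ProjectionExponent

/-! ### Projections of `N` and `Aut N`, and the automorphism part of H -/

section HolData

set_option linter.unusedSectionVars false

variable {N : Type*} [CommGroup N] [IsCyclic N]

/-- The standing hypotheses on a cyclic group whose order is the product of a Cunningham chain. -/
structure HolData (l : ℕ) (p : ℕ → ℕ) (x s : ℕ) (σ : ℕ → N) (α β : ℕ → MulAut N) : Prop where
  chain : IsCunninghamChain l p
  card : Nat.card N = ∏ i ∈ Finset.Icc 1 l, p i
  last : p l = 2 ^ x * s + 1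
  odd : Odd s
  gen : CyclicHol.IsGeneratorChoice l p x s σ α β

/-- The automorphism `α (i - 1)`, of order `p i`, that is paired with `σ i`; trivial for `i = 1`. -/
def pre (α : ℕ → MulAut N) (i : ℕ) : MulAut N := if i = 1 then 1 else α (i - 1)

/-- The element `[σ i, α (i - 1) ^ t]`, also for `i = 1`, where it is `σ 1`. -/
def tw (σ : ℕ → N) (α : ℕ → MulAut N) (i t : ℕ) : Hol N := ⟨σ i, pre α i ^ t⟩

/-- The component of `g` for the index `i`. -/
def comp (l : ℕ) (p : ℕ → ℕ) (i : ℕ) (g : Hol N) : Hol N :=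
  ⟨g.left ^ projExp l p i, g.right ^ projExp l p i⟩

/-- The group `⟨α 1, …, α (l - 1)⟩`. -/
def autB (l : ℕ) (α : ℕ → MulAut N) : Subgroup (MulAut N) :=
  Subgroup.closure {φ | ∃ i, 1 ≤ i ∧ i < l ∧ φ = α i}

theorem pre_of_two_le (α : ℕ → MulAut N) {i : ℕ} (hi : 2 ≤ i) : pre α i = α (i - 1) :=
  if_neg (by omega)

theorem tw_of_two_le (σ : ℕ → N) (α : ℕ → MulAut N) {i : ℕ} (hi : 2 ≤ i) (t : ℕ) :
    tw σ α i t = CyclicHol.twisted σ α i t := by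
  rw [tw, pre_of_two_le α hi, CyclicHol.twisted]

theorem tw_one (σ : ℕ → N) (α : ℕ → MulAut N) (t : ℕ) : tw σ α 1 t = Hol.ofN (σ 1) := by
  rw [tw, pre, if_pos rfl, one_pow]
  rfl

theorem tw_zero (σ : ℕ → N) (α : ℕ → MulAut N) (i : ℕ) : tw σ α i 0 = Hol.ofN (σ i) := by
  rw [tw, pow_zero]
  rfl

namespace HolData

variable {l : ℕ} {p : ℕ → ℕ} {x s : ℕ} {σ : ℕ → N} {α β : ℕ → MulAut N}
  (h : HolData l p x s σ α β)

include h

theorem finite : Finite N := by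
  refine Nat.finite_of_card_ne_zero ?_
  rw [h.card]
  exact Finset.prod_ne_zero_iff.2 fun i hi => (h.chain.prime i hi).ne_zero

theorem orderOf_sigma {i : ℕ} (hi : i ∈ Finset.Icc 1 l) : orderOf (σ i) = p i :=
  h.gen.orderOf_σ i hi

theorem pow_prod (y : N) : y ^ ∏ i ∈ Finset.Icc 1 l, p i = 1 := by
  rw [← h.card]
  exact pow_card_eq_one'

theorem mem_zpowers_iff {i : ℕ} (hi : i ∈ Finset.Icc 1 l) {y : N} :
    y ∈ Subgroup.zpowers (σ i) ↔ y ^ p i = 1 := by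
  have := h.finite
  rw [← h.orderOf_sigma hi]
  refine ⟨?_, mem_zpowers_of_pow_orderOf_eq_one⟩
  rintro ⟨k, rfl⟩
  simp only
  rw [← zpow_natCast, ← zpow_mul, mul_comm, zpow_mul, zpow_natCast, pow_orderOf_eq_one, one_zpow]

theorem pow_projExp_mem_zpowers {i : ℕ} (hi : i ∈ Finset.Icc 1 l) (y : N) :
    y ^ projExp l p i ∈ Subgroup.zpowers (σ i) := by
  rw [h.mem_zpowers_iff hi]
  obtain ⟨c, hc⟩ := h.chain.prod_dvd_projExp_mul hi
  rw [← pow_mul, hc, pow_mul, h.pow_prod, one_pow]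

theorem aut_ext {φ ψ : MulAut N} (hφ : ∀ i ∈ Finset.Icc 1 l, φ (σ i) = ψ (σ i)) : φ = ψ := by
  ext y
  refine h.chain.eq_of_pow_projExp_eq (h.pow_prod _) (h.pow_prod _) fun i hi => ?_
  rw [← map_pow, ← map_pow]
  exact apply_eq_apply_of_mem_zpowers (hφ i hi) (h.pow_projExp_mem_zpowers hi y)

theorem alpha_fix {i j : ℕ} (hi : i ∈ Finset.Icc 1 l) (hj : j ∈ Finset.Icc 1 l) (hij : j ≠ i) :
    α i (σ j) = σ j := h.gen.α_fix i hi j hj hij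

theorem pre_fix {i j : ℕ} (hi : i ∈ Finset.Icc 1 l) (hj : j ∈ Finset.Icc 1 l) (hij : j + 1 ≠ i) :
    pre α i (σ j) = σ j := by
  rw [Finset.mem_Icc] at hi
  rw [pre]
  split_ifs with h1
  · rfl
  · exact h.alpha_fix (Finset.mem_Icc.2 ⟨by omega, by omega⟩) hj (by omega)

theorem orderOf_pre {i : ℕ} (hi : i ∈ Finset.Icc 2 l) : orderOf (pre α i) = p i := by
  rw [Finset.mem_Icc] at hi
  rw [pre_of_two_le α hi.1, h.gen.orderOf_α (i - 1) (by omega) (by omega), Nat.sub_add_cancel]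
  omega

theorem pre_pow {i : ℕ} (hi : i ∈ Finset.Icc 1 l) : pre α i ^ p i = 1 := by
  rw [Finset.mem_Icc] at hi
  rcases hi.1.lt_or_eq with h1 | h1
  · rw [← h.orderOf_pre (Finset.mem_Icc.2 ⟨h1, hi.2⟩), pow_orderOf_eq_one]
  · rw [← h1, pre, if_pos rfl, one_pow]

theorem pow_eq_one_of_mem_zpowers_pre {i : ℕ} (hi : i ∈ Finset.Icc 1 l) {φ : MulAut N}
    (hφ : φ ∈ Subgroup.zpowers (pre α i)) : φ ^ p i = 1 := by
  obtain ⟨k, rfl⟩ := hφ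
  simp only
  rw [← zpow_natCast, ← zpow_mul, mul_comm, zpow_mul, zpow_natCast, h.pre_pow hi, one_zpow]

theorem apply_pow_sub_one {i m : ℕ} (hi : i ∈ Finset.Icc 1 l) (φ : MulAut N)
    (hm : p i - 1 ∣ m) : (φ ^ m) (σ i) = σ i :=
  pow_orderOf_sub_one_apply (by rw [h.orderOf_sigma hi]; exact h.chain.prime i hi) φ
    (by rwa [h.orderOf_sigma hi])

/-- An automorphism that moves only `σ i` is determined by the image of `σ i`, and its powers
exhaust the multipliers of the same order. -/
theorem exists_pow_apply_eq' {i : ℕ} (hi : i ∈ Finset.Icc 1 l) {γ : MulAut N} {d : ℕ}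
    (hγ : ∀ j ∈ Finset.Icc 1 l, j ≠ i → γ (σ j) = σ j) (hord : orderOf γ = d) (hd : 0 < d)
    {φ : MulAut N} (hφ : (φ ^ d) (σ i) = σ i) : ∃ k : ℕ, (γ ^ k) (σ i) = φ (σ i) := by
  subst hord
  refine exists_pow_apply_eq (by rw [h.orderOf_sigma hi]; exact h.chain.prime i hi) hd ?_ hφ
  intro m hm
  refine h.aut_ext fun j hj => ?_
  rcases eq_or_ne j i with rfl | hji
  · rw [hm, MulAut.one_apply]
  · rw [← multiplier_eq_iff, map_pow, (multiplier_eq_one_iff _ _).2 (hγ j hj hji), one_pow, map_one]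

/-- Since p_j − 1 divides the exponent for j ≠ i − 1, the power fixes all these σ_j. On σ_{i−1} the
factor 2 leaves a multiplier killed by p_i, and the powers of α_{i−1} realise all of those. For i =
1 nothing is left. -/
theorem pow_projExp_mem_zpowers_pre {i : ℕ} (hi : i ∈ Finset.Icc 1 l) (φ : MulAut N) :
    φ ^ projExp l p i ∈ Subgroup.zpowers (pre α i) := by
  have hi' := Finset.mem_Icc.1 hi
  rcases hi'.1.lt_or_eq with h1 | h1
  · have hj : i - 1 ∈ Finset.Icc 1 l := Finset.mem_Icc.2 ⟨by omega, by omega⟩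
    have hi2 : i ∈ Finset.Icc 2 l := Finset.mem_Icc.2 ⟨h1, hi'.2⟩
    have hstep := h.chain.step (i - 1) (by omega) (by omega)
    rw [Nat.sub_add_cancel hi'.1] at hstep
    obtain ⟨k, hk⟩ := h.exists_pow_apply_eq' hj (γ := pre α i) (φ := φ ^ projExp l p i)
      (fun j hj hji => h.pre_fix hi hj (by omega)) (h.orderOf_pre hi2)
      (h.chain.prime i hi).pos (by
        rw [← pow_mul]
        refine h.apply_pow_sub_one hj φ ?_
        rw [hstep, Nat.add_sub_cancel]
        exact Nat.mul_dvd_mul_right (h.chain.two_dvd_projExp hi) _)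
    refine ⟨k, ?_⟩
    simp only [zpow_natCast]
    refine h.aut_ext fun j hj' => ?_
    rcases eq_or_ne j (i - 1) with rfl | hji
    · exact hk
    · rw [h.apply_pow_sub_one hj' φ (h.chain.sub_one_dvd_projExp hi hj' (by omega)),
        ← multiplier_eq_one_iff, map_pow,
        (multiplier_eq_one_iff _ _).2 (h.pre_fix hi hj' (by omega)), one_pow]
  · have : φ ^ projExp l p i = 1 := h.aut_ext fun j hj => by
      rw [h.apply_pow_sub_one hj φ (h.chain.sub_one_dvd_projExp hi hj
        (by rw [Finset.mem_Icc] at hj; omega)), MulAut.one_apply]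
    rw [this]
    exact Subgroup.one_mem _

theorem sigma_pow_eq_one {i : ℕ} (hi : i ∈ Finset.Icc 1 l) : σ i ^ p i = 1 := by
  rw [← h.orderOf_sigma hi, pow_orderOf_eq_one]

theorem pre_mem_autB {i : ℕ} (hi : i ∈ Finset.Icc 1 l) : pre α i ∈ autB l α := by
  rw [Finset.mem_Icc] at hi
  rw [pre]
  split_ifs with h1
  · exact Subgroup.one_mem _
  · exact Subgroup.subset_closure ⟨i - 1, by omega, by omega, rfl⟩

/-- Inverses need no separate case, as they are positive powers in a finite group. -/
theorem autB_induction {P : MulAut N → Prop} (hpre : ∀ i ∈ Finset.Icc 2 l, P (pre α i))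
    (hone : P 1) (hmul : ∀ φ ψ, P φ → P ψ → P (φ * ψ)) {φ : MulAut N} (hφ : φ ∈ autB l α) :
    P φ := by
  have := h.finite
  have : ∀ φ, P φ → P φ⁻¹ := by
    intro φ hP
    have hpow : ∀ m : ℕ, P (φ ^ m) := by
      intro m
      induction m with
      | zero => rwa [pow_zero]
      | succ m ih => rw [pow_succ]; exact hmul _ _ ih hP
    have : φ⁻¹ = φ ^ (orderOf φ - 1) := inv_eq_of_mul_eq_one_right
      (by rw [mul_pow_sub_one (orderOf_pos φ).ne', pow_orderOf_eq_one])
    rw [this]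
    exact hpow _
  rw [autB] at hφ
  induction hφ using Subgroup.closure_induction with
  | mem φ hφ =>
    obtain ⟨i, h1, h2, rfl⟩ := hφ
    have := hpre (i + 1) (Finset.mem_Icc.2 ⟨by omega, by omega⟩)
    rwa [pre_of_two_le α (by omega), Nat.add_sub_cancel] at this
  | one => exact hone
  | mul φ ψ _ _ h1 h2 => exact hmul _ _ h1 h2
  | inv φ _ h1 => exact this _ h1

theorem pow_prod_of_mem_autB {φ : MulAut N} (hφ : φ ∈ autB l α) :
    φ ^ ∏ i ∈ Finset.Icc 1 l, p i = 1 := by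
  refine h.autB_induction (P := fun φ => φ ^ ∏ i ∈ Finset.Icc 1 l, p i = 1) (fun i hi => ?_)
    (one_pow _) (fun φ ψ h1 h2 => ?_) hφ
  · have hi' : i ∈ Finset.Icc 1 l := by rw [Finset.mem_Icc] at hi ⊢; omega
    obtain ⟨c, hc⟩ := Finset.dvd_prod_of_mem p hi'
    rw [hc, pow_mul, h.pre_pow hi', one_pow]
  · rw [(MulAut.commute_of_isCyclic φ ψ).mul_pow, h1, h2, one_mul]

theorem autB_apply_last {φ : MulAut N} (hφ : φ ∈ autB l α) : φ (σ l) = σ l := by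
  have hl : l ∈ Finset.Icc 1 l := Finset.mem_Icc.2 ⟨h.chain.one_le, le_rfl⟩
  refine h.autB_induction (P := fun φ => φ (σ l) = σ l) (fun i hi => ?_)
    rfl (fun φ ψ h1 h2 => ?_) hφ
  · have hi' : i ∈ Finset.Icc 1 l := by rw [Finset.mem_Icc] at hi ⊢; omega
    exact h.pre_fix hi' hl (by rw [Finset.mem_Icc] at hi; omega)
  · rw [MulAut.mul_apply, h2, h1]

/-- Among the generators only α_i = `pre α (i + 1)` moves σ_i, so the action on σ_i is visible in
the component of index i + 1. -/
theorem autB_apply {φ : MulAut N} (hφ : φ ∈ autB l α) {i : ℕ} (hi : 1 ≤ i) (hil : i < l) :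
    φ (σ i) = (φ ^ projExp l p (i + 1)) (σ i) := by
  have hi1 : i ∈ Finset.Icc 1 l := Finset.mem_Icc.2 ⟨hi, hil.le⟩
  have hi2 : i + 1 ∈ Finset.Icc 1 l := Finset.mem_Icc.2 ⟨by omega, hil⟩
  simp_rw [← multiplier_eq_iff, map_pow]
  refine h.autB_induction
    (P := fun φ => multiplier (σ i) φ = multiplier (σ i) φ ^ projExp l p (i + 1))
    (fun j hj => ?_) (by rw [map_one, one_pow])
    (fun φ ψ h1 h2 => by rw [map_mul, mul_pow, ← h1, ← h2]) hφ
  have hj' : j ∈ Finset.Icc 1 l := by rw [Finset.mem_Icc] at hj ⊢; omega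
  rcases eq_or_ne (i + 1) j with rfl | hne
  · rw [← map_pow, h.chain.pow_projExp_of_pow_eq_one hi2 (h.pre_pow hi2)]
  · rw [(multiplier_eq_one_iff _ _).2 (h.pre_fix hj' hi1 hne), one_pow]

theorem autB_apply_eq_self {φ : MulAut N} (hφ : φ ∈ autB l α) {i : ℕ} (hi : i ∈ Finset.Icc 1 l)
    (h1 : i < l → φ ^ projExp l p (i + 1) = 1) : φ (σ i) = σ i := by
  have hi' := Finset.mem_Icc.1 hi
  rcases hi'.2.lt_or_eq with hlt | heq
  · rw [h.autB_apply hφ hi'.1 hlt, h1 hlt, MulAut.one_apply]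
  · rw [heq]; exact h.autB_apply_last hφ

/-- The σ_i generate N, so H contains all of N and only the automorphism part is constrained. -/
theorem mem_hallH {g : Hol N} : g ∈ CyclicHol.hallH l σ α ↔ g.right ∈ autB l α := by
  constructor
  · intro hg
    have : CyclicHol.hallH l σ α ≤ (autB l α).comap SemidirectProduct.rightHom := by
      refine (Subgroup.closure_le _).2 ?_
      rintro _ (⟨i, h1, h2, rfl⟩ | ⟨i, h1, h2, rfl⟩)
      · exact (autB l α).one_mem
      · exact Subgroup.subset_closure ⟨i, h1, h2, rfl⟩
    exact this hg
  · intro hg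
    rw [← SemidirectProduct.inl_left_mul_inr_right g]
    refine Subgroup.mul_mem _ ?_ ?_
    · change g.left ∈ (CyclicHol.hallH l σ α).comap
        (SemidirectProduct.inl : N →* Hol N)
      refine h.chain.mem_of_pow_projExp_mem (h.pow_prod _) fun i hi => ?_
      have hi' := Finset.mem_Icc.1 hi
      refine (Subgroup.zpowers_le.2 ?_) (h.pow_projExp_mem_zpowers hi _)
      exact Subgroup.subset_closure (Or.inl ⟨i, hi'.1, hi'.2, rfl⟩)
    · have : autB l α ≤ (CyclicHol.hallH l σ α).comap SemidirectProduct.inr := by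
        refine (Subgroup.closure_le _).2 ?_
        rintro _ ⟨i, h1, h2, rfl⟩
        exact Subgroup.subset_closure (Or.inr ⟨i, h1, h2, rfl⟩)
      exact this hg

end HolData
end HolData

/-! ### Ordered products of sets -/

theorem Set.mem_prod_map_range' {G : Type*} [Monoid G] {f : ℕ → Set G} {m : ℕ} {g : G} :
    g ∈ ((List.range' 1 m).map f).prod ↔
      ∃ a : ℕ → G, (∀ i ∈ Finset.Icc 1 m, a i ∈ f i) ∧ ((List.range' 1 m).map a).prod = g := by
  induction m generalizing g with
  | zero => simp [eq_comm]
  | succ m ih =>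
    rw [List.range'_1_concat, List.map_append, List.prod_append, Set.mem_mul]
    constructor
    · rintro ⟨u, hu, v, hv, rfl⟩
      obtain ⟨a, ha, rfl⟩ := ih.1 hu
      rw [List.map_singleton, List.prod_singleton] at hv
      refine ⟨Function.update a (1 + m) v, fun i hi => ?_, ?_⟩
      · rw [Finset.mem_Icc] at hi
        rcases eq_or_ne i (1 + m) with rfl | hne
        · rwa [Function.update_self]
        · rw [Function.update_of_ne hne]
          exact ha i (Finset.mem_Icc.2 ⟨hi.1, by omega⟩)
      · rw [List.map_append, List.prod_append, List.map_singleton, List.prod_singleton,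
          Function.update_self]
        congr 2
        refine List.map_congr_left fun i hi => ?_
        rw [List.mem_range'_1] at hi
        exact Function.update_of_ne (by omega) _ _
    · rintro ⟨a, ha, rfl⟩
      rw [List.map_append, List.prod_append]
      refine ⟨_, ih.2 ⟨a, fun i hi => ha i ?_, rfl⟩, _, ?_, rfl⟩
      · rw [Finset.mem_Icc] at hi ⊢
        omega
      · rw [List.map_singleton, List.map_singleton, List.prod_singleton, List.prod_singleton]
        exact ha _ (Finset.mem_Icc.2 ⟨by omega, by omega⟩)

theorem Subgroup.list_prod_map_range'_mem {G : Type*} [Group G] {M : Subgroup G} {m : ℕ}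
    {a : ℕ → G} (h : ∀ i ∈ Finset.Icc 1 m, a i ∈ M) : ((List.range' 1 m).map a).prod ∈ M := by
  refine M.list_prod_mem fun g hg => ?_
  obtain ⟨i, hi, rfl⟩ := List.mem_map.1 hg
  rw [List.mem_range'_1] at hi
  exact h i (Finset.mem_Icc.2 ⟨by omega, by omega⟩)

/-! ### Factorisation into components, and twisted elements of transitive subgroups -/

section HolData

set_option linter.unusedSectionVars false

variable {N : Type*} [CommGroup N] [IsCyclic N]

theorem Hol.zpow_mk {φ : MulAut N} {y : N} (hφ : φ y = y) (k : ℤ) :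
    (⟨y, φ⟩ : Hol N) ^ k = ⟨y ^ k, φ ^ k⟩ := by
  have hcomm : Commute (SemidirectProduct.inl y : Hol N) (SemidirectProduct.inr φ) := by
    refine SemidirectProduct.ext ?_ ?_ <;> simp [hφ]
  rw [SemidirectProduct.mk_eq_inl_mul_inr, hcomm.mul_zpow, ← map_zpow, ← map_zpow,
    ← SemidirectProduct.mk_eq_inl_mul_inr]

theorem Hol.pow_mk {φ : MulAut N} {y : N} (hφ : φ y = y) (k : ℕ) :
    (⟨y, φ⟩ : Hol N) ^ k = ⟨y ^ k, φ ^ k⟩ := by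
  simpa only [zpow_natCast] using Hol.zpow_mk hφ k

namespace HolData

variable {l : ℕ} {p : ℕ → ℕ} {x s : ℕ} {σ : ℕ → N} {α β : ℕ → MulAut N}
  (h : HolData l p x s σ α β)

include h

theorem zpowers_pow_projExp {i j : ℕ} (hi : i ∈ Finset.Icc 1 l) (hj : j ∈ Finset.Icc 1 l) {y : N}
    (hy : y ∈ Subgroup.zpowers (σ j)) : y ^ projExp l p i = if i = j then y else 1 := by
  rw [h.mem_zpowers_iff hj] at hy
  split_ifs with hij
  · subst hij
    exact h.chain.pow_projExp_of_pow_eq_one hi hy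
  · exact h.chain.pow_projExp_eq_one hi hj (Ne.symm hij) hy

theorem zpowers_pre_pow_projExp {i j : ℕ} (hi : i ∈ Finset.Icc 1 l) (hj : j ∈ Finset.Icc 1 l)
    {φ : MulAut N} (hφ : φ ∈ Subgroup.zpowers (pre α j)) :
    φ ^ projExp l p i = if i = j then φ else 1 := by
  have hφ := h.pow_eq_one_of_mem_zpowers_pre hj hφ
  split_ifs with hij
  · subst hij
    exact h.chain.pow_projExp_of_pow_eq_one hi hφ
  · exact h.chain.pow_projExp_eq_one hi hj (Ne.symm hij) hφ

theorem zpowers_pre_fix {i j : ℕ} (hi : i ∈ Finset.Icc 1 l) (hj : j ∈ Finset.Icc 1 l)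
    (hij : j + 1 ≠ i) {φ : MulAut N} (hφ : φ ∈ Subgroup.zpowers (pre α i)) : φ (σ j) = σ j := by
  rw [← multiplier_eq_one_iff]
  have : Subgroup.zpowers (pre α i) ≤ (multiplier (σ j)).ker := by
    rw [Subgroup.zpowers_le, MonoidHom.mem_ker, multiplier_eq_one_iff]
    exact h.pre_fix hi hj hij
  exact this hφ

/-- The automorphism part of the first m factors involves only α_1, …, α_{m−1}, hence fixes σ_{m+1}.
In increasing order the left coordinates therefore multiply as in a direct product, and the
projections recover the factors. -/
theorem prod_range'_aux {a : ℕ → Hol N}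
    (ha : ∀ i ∈ Finset.Icc 1 l,
      (a i).left ∈ Subgroup.zpowers (σ i) ∧ (a i).right ∈ Subgroup.zpowers (pre α i))
    {m : ℕ} (hm : m ≤ l) :
    ((List.range' 1 m).map a).prod.right ∈ autB l α ∧
    (∀ i ∈ Finset.Icc 1 l, m ≤ i → ((List.range' 1 m).map a).prod.right (σ i) = σ i) ∧
    ∀ i ∈ Finset.Icc 1 l,
      comp l p i ((List.range' 1 m).map a).prod = if i ≤ m then a i else 1 := by
  induction m with
  | zero =>
    refine ⟨Subgroup.one_mem _, fun _ _ _ => rfl, fun i hi => ?_⟩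
    rw [if_neg (by rw [Finset.mem_Icc] at hi; omega)]
    ext1
    · exact one_pow _
    · exact one_pow _
  | succ m ih =>
    obtain ⟨h1, h2, h3⟩ := ih (by omega)
    have hm1 : 1 + m ∈ Finset.Icc 1 l := Finset.mem_Icc.2 ⟨by omega, by omega⟩
    obtain ⟨hl, hr⟩ := ha _ hm1
    rw [List.range'_1_concat, List.map_append, List.prod_append, List.map_singleton,
      List.prod_singleton]
    set Q := ((List.range' 1 m).map a).prod with hQ
    have hleft : (Q * a (1 + m)).left = Q.left * (a (1 + m)).left := by
      rw [SemidirectProduct.mul_left]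
      congr 1
      exact apply_eq_self_of_mem_zpowers (h2 _ hm1 (by omega)) hl
    refine ⟨Subgroup.mul_mem _ h1 (Subgroup.zpowers_le.2 (h.pre_mem_autB hm1) hr), ?_, ?_⟩
    · intro i hi hmi
      rw [SemidirectProduct.mul_right, MulAut.mul_apply,
        h.zpowers_pre_fix hm1 hi (by omega) hr, h2 i hi (by omega)]
    · intro i hi
      have hc := h3 i hi
      have hcl := congrArg SemidirectProduct.left hc
      have hcr := congrArg SemidirectProduct.right hc
      simp only [comp] at hcl hcr
      have hl' := h.zpowers_pow_projExp hi hm1 hl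
      have hr' := h.zpowers_pre_pow_projExp hi hm1 hr
      have : comp l p i (Q * a (1 + m)) =
          ⟨Q.left ^ projExp l p i * (a (1 + m)).left ^ projExp l p i,
            Q.right ^ projExp l p i * (a (1 + m)).right ^ projExp l p i⟩ := by
        rw [comp, hleft, mul_pow, SemidirectProduct.mul_right,
          (MulAut.commute_of_isCyclic _ _).mul_pow]
      rw [this, hcl, hcr, hl', hr']
      rcases lt_trichotomy i (1 + m) with hlt | rfl | hgt
      · rw [if_pos (by omega), if_neg (by omega), if_neg (by omega), if_pos (by omega)]
        simp
      · rw [if_neg (by omega), if_pos rfl, if_pos rfl, if_pos (by omega)]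
        simp
      · rw [if_neg (by omega), if_neg (by omega), if_neg (by omega), if_neg (by omega)]
        ext1 <;> simp

theorem comp_prod {a : ℕ → Hol N}
    (ha : ∀ i ∈ Finset.Icc 1 l,
      (a i).left ∈ Subgroup.zpowers (σ i) ∧ (a i).right ∈ Subgroup.zpowers (pre α i))
    {i : ℕ} (hi : i ∈ Finset.Icc 1 l) : comp l p i ((List.range' 1 l).map a).prod = a i := by
  rw [(h.prod_range'_aux ha le_rfl).2.2 i hi, if_pos (Finset.mem_Icc.1 hi).2]

theorem prod_right_mem {a : ℕ → Hol N}
    (ha : ∀ i ∈ Finset.Icc 1 l,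
      (a i).left ∈ Subgroup.zpowers (σ i) ∧ (a i).right ∈ Subgroup.zpowers (pre α i)) :
    ((List.range' 1 l).map a).prod.right ∈ autB l α :=
  (h.prod_range'_aux ha le_rfl).1

theorem ext_comp {g k : Hol N} (hg : g.right ∈ autB l α) (hk : k.right ∈ autB l α)
    (hgk : ∀ i ∈ Finset.Icc 1 l, comp l p i g = comp l p i k) : g = k := by
  ext1
  · exact h.chain.eq_of_pow_projExp_eq (h.pow_prod _) (h.pow_prod _)
      fun i hi => congrArg SemidirectProduct.left (hgk i hi)
  · exact h.chain.eq_of_pow_projExp_eq (h.pow_prod_of_mem_autB hg) (h.pow_prod_of_mem_autB hk)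
      fun i hi => congrArg SemidirectProduct.right (hgk i hi)

theorem comp_mem (g : Hol N) : ∀ i ∈ Finset.Icc 1 l,
    (comp l p i g).left ∈ Subgroup.zpowers (σ i) ∧
      (comp l p i g).right ∈ Subgroup.zpowers (pre α i) :=
  fun _ hi => ⟨h.pow_projExp_mem_zpowers hi _, h.pow_projExp_mem_zpowers_pre hi _⟩

theorem prod_comp {g : Hol N} (hg : g.right ∈ autB l α) :
    ((List.range' 1 l).map fun i => comp l p i g).prod = g :=
  h.ext_comp (h.prod_right_mem (h.comp_mem g)) hg fun _ hi => h.comp_prod (h.comp_mem g) hi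

theorem tw_zpow {i : ℕ} (hi : i ∈ Finset.Icc 1 l) (t : ℕ) (k : ℤ) :
    tw σ α i t ^ k = ⟨σ i ^ k, (pre α i ^ t) ^ k⟩ :=
  Hol.zpow_mk (h.zpowers_pre_fix hi hi (by omega) (Subgroup.npow_mem_zpowers _ _)) k

theorem tw_zpowers_mem {i : ℕ} (hi : i ∈ Finset.Icc 1 l) {t : ℕ} {g : Hol N}
    (hg : g ∈ Subgroup.zpowers (tw σ α i t)) :
    g.left ∈ Subgroup.zpowers (σ i) ∧ g.right ∈ Subgroup.zpowers (pre α i) := by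
  obtain ⟨k, rfl⟩ := hg
  simp only [h.tw_zpow hi]
  exact ⟨Subgroup.zpow_mem_zpowers _ _,
    Subgroup.zpow_mem _ (Subgroup.npow_mem_zpowers _ _) _⟩

/-- An exponent killing σ_i is a multiple of p_i and so kills α_{i−1} too: the cyclic group is a
graph over ⟨σ_i⟩. -/
theorem mem_zpowers_tw_of_left_eq_one {i : ℕ} (hi : i ∈ Finset.Icc 1 l) {t : ℕ} {g : Hol N}
    (hg : g ∈ Subgroup.zpowers (tw σ α i t)) (hl : g.left = 1) : g = 1 := by
  obtain ⟨k, rfl⟩ := hg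
  simp only [h.tw_zpow hi] at hl ⊢
  have hk : (p i : ℤ) ∣ k := by
    rw [← h.orderOf_sigma hi]
    exact orderOf_dvd_iff_zpow_eq_one.2 hl
  obtain ⟨c, rfl⟩ := hk
  rw [hl, ← zpow_natCast, ← zpow_mul, mul_left_comm, zpow_mul, zpow_natCast, h.pre_pow hi,
    one_zpow]
  rfl

/-- A subgroup containing all `[σ i, α (i - 1) ^ t i]` contains, over each `y ∈ N`, an element all
of whose components are powers of these. -/
theorem exists_mem_left_eq {M : Subgroup (Hol N)} {t : ℕ → ℕ}
    (hM : ∀ i ∈ Finset.Icc 1 l, tw σ α i (t i) ∈ M) (y : N) :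
    ∃ g ∈ M, g.left = y ∧ g.right ∈ autB l α ∧
      ∀ i ∈ Finset.Icc 1 l, comp l p i g ∈ Subgroup.zpowers (tw σ α i (t i)) := by
  have hex : ∀ i, ∃ k : ℤ, i ∈ Finset.Icc 1 l → σ i ^ k = y ^ projExp l p i := by
    intro i
    by_cases hi : i ∈ Finset.Icc 1 l
    · obtain ⟨k, hk⟩ := h.pow_projExp_mem_zpowers hi y
      exact ⟨k, fun _ => hk⟩
    · exact ⟨0, fun hi' => absurd hi' hi⟩
  choose k hk using hex
  have ha : ∀ i ∈ Finset.Icc 1 l, (tw σ α i (t i) ^ k i).left ∈ Subgroup.zpowers (σ i) ∧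
      (tw σ α i (t i) ^ k i).right ∈ Subgroup.zpowers (pre α i) :=
    fun i hi => h.tw_zpowers_mem hi (Subgroup.zpow_mem_zpowers _ _)
  refine ⟨((List.range' 1 l).map fun i => tw σ α i (t i) ^ k i).prod,
    Subgroup.list_prod_map_range'_mem fun i hi => M.zpow_mem (hM i hi) _, ?_,
    h.prod_right_mem ha, fun i hi => ?_⟩
  · refine h.chain.eq_of_pow_projExp_eq (h.pow_prod _) (h.pow_prod _) fun i hi => ?_
    have := congrArg SemidirectProduct.left (h.comp_prod ha hi)
    rw [h.tw_zpow hi] at this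
    exact this.trans (hk i hi)
  · rw [h.comp_prod ha hi]
    exact Subgroup.zpow_mem_zpowers _ _

/-- The orbit of 1 is the set of left coordinates of M. -/
theorem isPretransitive_of_tw_mem {M : Subgroup (Hol N)} {t : ℕ → ℕ}
    (hM : ∀ i ∈ Finset.Icc 1 l, tw σ α i (t i) ∈ M) : MulAction.IsPretransitive M N := by
  refine MulAction.IsPretransitive.of_orbit (x₀ := (1 : N)) fun y => ?_
  obtain ⟨g, hg, hl, -⟩ := h.exists_mem_left_eq hM y
  refine ⟨⟨g, hg⟩, ?_⟩
  change g.left * g.right 1 = y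
  rw [map_one, mul_one, hl]

theorem exists_mem_left_of_isPretransitive {M : Subgroup (Hol N)}
    [MulAction.IsPretransitive M N] (y : N) : ∃ φ : MulAut N, (⟨y, φ⟩ : Hol N) ∈ M := by
  obtain ⟨⟨g, hg⟩, hgy⟩ := MulAction.exists_smul_eq M (1 : N) y
  have hgy : g.left * g.right 1 = y := hgy
  rw [map_one, mul_one] at hgy
  exact ⟨g.right, by rw [← hgy]; exact hg⟩

/-- A transitive subgroup contains `[σ i, α (i - 1) ^ t]` for some `t`. -/
theorem exists_tw_mem {M : Subgroup (Hol N)} [MulAction.IsPretransitive M N] {i : ℕ}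
    (hi : i ∈ Finset.Icc 1 l) : ∃ t < p i, tw σ α i t ∈ M := by
  have hpi := h.chain.prime i hi
  have := Fact.mk hpi
  have hord := h.orderOf_sigma hi
  have := Fact.mk (hord ▸ hpi)
  choose φ hφ using fun k : Fin (orderOf (σ i)) =>
    h.exists_mem_left_of_isPretransitive (M := M) (σ i ^ (k : ℕ))
  -- Pigeonhole: p_i elements of M over ⟨σ_i⟩, but only p_i − 1 nonzero multipliers. The quotient of
  -- two elements with equal multiplier is [y, ψ] with 1 ≠ y ∈ ⟨σ_i⟩ and ψ fixing σ_i.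
  obtain ⟨k, -, m, -, hkm, hmul⟩ := Finset.exists_ne_map_eq_of_card_lt_of_maps_to
    (s := (Finset.univ : Finset (Fin (orderOf (σ i)))))
    (t := (Finset.univ : Finset (ZMod (orderOf (σ i)))).erase 0)
    (f := fun k => multiplier (σ i) (φ k)) (by
      rw [Finset.card_erase_of_mem (Finset.mem_univ _), Finset.card_univ, Finset.card_univ,
        ZMod.card, Fintype.card_fin]
      have := hpi.pos
      omega)
    (fun k _ => Finset.mem_erase.2
      ⟨((Group.isUnit (φ k)).map (multiplier (σ i))).ne_zero, Finset.mem_univ _⟩)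
  have hfix : (φ k * (φ m)⁻¹) (σ i) = σ i := by
    have := (multiplier_eq_iff _ _ _).1 hmul
    rw [(MulAut.commute_of_isCyclic _ _).eq, MulAut.mul_apply, this, ← MulAut.mul_apply,
      inv_mul_cancel, MulAut.one_apply]
  have hmem := M.mul_mem (hφ k) (M.inv_mem (hφ m))
  have hprod : (⟨σ i ^ (k : ℕ), φ k⟩ * (⟨σ i ^ (m : ℕ), φ m⟩)⁻¹ : Hol N) =
      ⟨σ i ^ ((k : ℤ) - m), φ k * (φ m)⁻¹⟩ := by
    ext1
    · change σ i ^ (k : ℕ) * φ k ((φ m)⁻¹ (σ i ^ (m : ℕ))⁻¹) = _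
      rw [← MulAut.mul_apply, map_inv, map_pow, hfix, zpow_sub, zpow_natCast, zpow_natCast]
    · rfl
  rw [hprod] at hmem
  set ψ := φ k * (φ m)⁻¹
  set y := σ i ^ ((k : ℤ) - m) with hy
  have hyfix : ψ y = y := by rw [hy, map_zpow, hfix]
  have hy1 : y ≠ 1 := by
    intro h1
    rw [hy, zpow_sub, mul_inv_eq_one, zpow_natCast, zpow_natCast] at h1
    exact hkm (Fin.ext (pow_injOn_Iio_orderOf k.2 m.2 h1))
  have hyp : y ^ p i = 1 := (h.mem_zpowers_iff hi).1 (Subgroup.zpow_mem_zpowers _ _)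
  have hyord : orderOf y = p i := orderOf_eq_prime hyp hy1
  obtain ⟨c, hc⟩ : σ i ∈ Subgroup.zpowers y := by
    have := h.finite
    refine mem_zpowers_of_pow_orderOf_eq_one ?_
    rw [hyord, ← hord, pow_orderOf_eq_one]
  -- As ψ fixes y, powers are taken coordinatewise: this one keeps y and moves ψ into ⟨α_{i−1}⟩. A
  -- further c-th power turns y into σ_i.
  have hpow := M.pow_mem hmem (projExp l p i)
  rw [Hol.pow_mk hyfix, h.chain.pow_projExp_of_pow_eq_one hi hyp] at hpow
  obtain ⟨d, hd⟩ := h.pow_projExp_mem_zpowers_pre hi ψ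
  have hpow := M.zpow_mem hpow c
  rw [← hd] at hpow
  have hfix2 : (pre α i ^ d) y = y := by
    simp only at hd
    rw [hd, ← multiplier_eq_one_iff, map_pow, (multiplier_eq_one_iff _ _).2 hyfix, one_pow]
  simp only at hpow hc
  rw [Hol.zpow_mk hfix2, hc, ← zpow_mul] at hpow
  refine ⟨((d * c) % (p i : ℤ)).toNat, ?_, ?_⟩
  · have := Int.emod_lt_of_pos (d * c) (b := p i) (by exact_mod_cast hpi.pos)
    omega
  · have hnn := Int.emod_nonneg (d * c) (b := (p i : ℤ)) (by exact_mod_cast hpi.ne_zero)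
    rw [tw, ← zpow_natCast, Int.toNat_of_nonneg hnn]
    have : pre α i ^ (d * c % (p i : ℤ)) = pre α i ^ (d * c) := by
      conv_rhs => rw [← Int.emod_add_mul_ediv (d * c) (p i), zpow_add, zpow_mul, zpow_natCast,
        h.pre_pow hi, one_zpow, mul_one]
    rw [this]
    exact hpow

end HolData
end HolData

/-! ### The Hall subgroup and the orders of the factors -/

section HolData

set_option linter.unusedSectionVars false

variable {N : Type*} [CommGroup N] [IsCyclic N]

theorem Subgroup.mem_of_pow_mem_of_coprime {G : Type*} [Group G] {H : Subgroup G} {g : G}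
    {a b : ℕ} (ha : g ^ a ∈ H) (hb : g ^ b ∈ H) (hab : a.Coprime b) : g ∈ H := by
  have hz : g ^ (Nat.gcd a b : ℤ) ∈ H := by
    rw [Nat.gcd_eq_gcd_ab, zpow_add, zpow_mul, zpow_mul, zpow_natCast, zpow_natCast]
    exact H.mul_mem (H.zpow_mem ha _) (H.zpow_mem hb _)
  rwa [Nat.Coprime.gcd_eq_one hab, Nat.cast_one, zpow_one] at hz

namespace HolData

variable {l : ℕ} {p : ℕ → ℕ} {x s : ℕ} {σ : ℕ → N} {α β : ℕ → MulAut N}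
  (h : HolData l p x s σ α β)

include h

theorem finite_hol : Finite (Hol N) := by
  have := h.finite
  exact Finite.of_equiv _ (SemidirectProduct.equivProd (φ := MonoidHom.id (MulAut N))).symm

theorem mem_primeFactors {q : ℕ} :
    q ∈ (Nat.card N).primeFactors ↔ ∃ i ∈ Finset.Icc 1 l, q = p i := by
  rw [h.card]
  constructor
  · intro hq
    have hq' := Nat.prime_of_mem_primeFactors hq
    obtain ⟨i, hi, hdvd⟩ := (hq'.prime.dvd_finsetProd_iff p).1 (Nat.dvd_of_mem_primeFactors hq)
    exact ⟨i, hi, (Nat.prime_dvd_prime_iff_eq hq' (h.chain.prime i hi)).1 hdvd⟩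
  · rintro ⟨i, hi, rfl⟩
    exact Nat.mem_primeFactors.2 ⟨h.chain.prime i hi, Finset.dvd_prod_of_mem p hi,
      Finset.prod_ne_zero_iff.2 fun j hj => (h.chain.prime j hj).ne_zero⟩

/-- An automorphism lies in a subgroup that contains each of its local factors. -/
theorem mem_of_local {S : Subgroup (MulAut N)} {φ : MulAut N}
    (hφ : ∀ i ∈ Finset.Icc 1 l, ∃ γ ∈ S, γ (σ i) = φ (σ i) ∧
      ∀ j ∈ Finset.Icc 1 l, j ≠ i → γ (σ j) = σ j) : φ ∈ S := by
  have key : ∀ m ≤ l, ∃ γ ∈ S, (∀ j ∈ Finset.Icc 1 l, j ≤ m → γ (σ j) = φ (σ j)) ∧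
      ∀ j ∈ Finset.Icc 1 l, m < j → γ (σ j) = σ j := by
    intro m
    induction m with
    | zero =>
      intro _
      refine ⟨1, S.one_mem, fun j hj hj0 => ?_, fun _ _ _ => rfl⟩
      rw [Finset.mem_Icc] at hj
      omega
    | succ m ih =>
      intro hm
      obtain ⟨γ, hγ, h1, h2⟩ := ih (by omega)
      have hm1 : m + 1 ∈ Finset.Icc 1 l := Finset.mem_Icc.2 ⟨by omega, hm⟩
      obtain ⟨δ, hδ, h3, h4⟩ := hφ _ hm1
      refine ⟨δ * γ, S.mul_mem hδ hγ, fun j hj hjm => ?_, fun j hj hjm => ?_⟩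
      · rcases eq_or_ne j (m + 1) with rfl | hne
        · rw [MulAut.mul_apply, h2 _ hj (by omega), h3]
        · rw [(MulAut.commute_of_isCyclic δ γ).eq, MulAut.mul_apply, h4 j hj hne,
            h1 j hj (by omega)]
      · rw [MulAut.mul_apply, h2 j hj (by omega), h4 j hj (by omega)]
  obtain ⟨γ, hγ, h1, -⟩ := key l le_rfl
  rwa [h.aut_ext fun j hj => h1 j hj (Finset.mem_Icc.1 hj).2] at hγ

/-- The factor 2 reduces the multiplier on σ_i, i < l, to one killed by p_{i+1}, which a power of
α_i realises; the factor p_l − 1 kills the action on σ_l. This exponent is prime to n, which is what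
the Hall property uses. -/
theorem pow_mem_autB (φ : MulAut N) : φ ^ (2 * (p l - 1)) ∈ autB l α := by
  refine h.mem_of_local fun i hi => ?_
  have hi' := Finset.mem_Icc.1 hi
  rcases hi'.2.lt_or_eq with hlt | rfl
  · have hi2 : i + 1 ∈ Finset.Icc 1 l := Finset.mem_Icc.2 ⟨by omega, hlt⟩
    have hstep := h.chain.step i hi'.1 hlt
    obtain ⟨k, hk⟩ := h.exists_pow_apply_eq' hi (γ := α i) (φ := φ ^ (2 * (p l - 1)))
      (fun j hj hji => h.alpha_fix hi hj hji) (h.gen.orderOf_α i hi'.1 hlt)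
      (h.chain.prime _ hi2).pos (by
        rw [← pow_mul]
        refine h.apply_pow_sub_one hi φ ?_
        rw [hstep, Nat.add_sub_cancel]
        exact Nat.mul_dvd_mul_right (dvd_mul_right _ _) _)
    refine ⟨α i ^ k, (autB l α).pow_mem (Subgroup.subset_closure ⟨i, hi'.1, hlt, rfl⟩) _, hk,
      fun j hj hji => ?_⟩
    rw [← multiplier_eq_one_iff, map_pow, (multiplier_eq_one_iff _ _).2 (h.alpha_fix hi hj hji),
      one_pow]
  · exact ⟨1, Subgroup.one_mem _, (h.apply_pow_sub_one hi φ (dvd_mul_left _ _)).symm,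
      fun _ _ _ => rfl⟩

theorem pow_mem_hallH (g : Hol N) : g ^ (2 * (p l - 1)) ∈ CyclicHol.hallH l σ α := by
  rw [h.mem_hallH]
  have : (g ^ (2 * (p l - 1))).right = g.right ^ (2 * (p l - 1)) :=
    map_pow SemidirectProduct.rightHom g _
  rw [this]
  exact h.pow_mem_autB _

theorem not_dvd_exponent {i : ℕ} (hi : i ∈ Finset.Icc 1 l) : ¬ p i ∣ 2 * (p l - 1) := by
  intro hdvd
  have h3 := h.chain.three_le hi
  have hl := h.chain.last_le hi
  have hl3 := h.chain.three_le (Finset.mem_Icc.2 ⟨h.chain.one_le, le_rfl⟩)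
  rcases (h.chain.prime i hi).dvd_mul.1 hdvd with h2 | h2
  · have := Nat.le_of_dvd (by norm_num) h2
    omega
  · have := Nat.le_of_dvd (by omega) h2
    omega

theorem hallH_normal : (CyclicHol.hallH l σ α).Normal := by
  refine ⟨fun g hg k => ?_⟩
  rw [h.mem_hallH] at hg ⊢
  rw [SemidirectProduct.mul_right, SemidirectProduct.mul_right, SemidirectProduct.inv_right,
    (MulAut.commute_of_isCyclic k.right g.right).eq, mul_inv_cancel_right]
  exact hg

/-- Cauchy's theorem twice. An element of H of prime order q ∤ n has both coordinates killed by
coprime exponents q and n. An element of order p_i in the quotient by H would be killed by 2(p_l −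
1), which is prime to p_i. -/
theorem isHallSubgroup_hallH :
    IsHallSubgroup (Nat.card N).primeFactors (CyclicHol.hallH l σ α) := by
  have := h.finite_hol
  have := h.finite
  constructor
  · intro q hq hdvd
    have := Fact.mk hq
    obtain ⟨⟨g, hg⟩, hord⟩ := exists_prime_orderOf_dvd_card' q hdvd
    rw [Subgroup.orderOf_mk] at hord
    rw [h.mem_hallH] at hg
    by_contra hmem
    have hcop : q.Coprime (∏ i ∈ Finset.Icc 1 l, p i) := by
      rw [← h.card, hq.coprime_iff_not_dvd]
      exact fun hd => hmem (Nat.mem_primeFactors.2 ⟨hq, hd, Nat.card_pos.ne'⟩)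
    have hgq : g ^ q = 1 := by rw [← hord, pow_orderOf_eq_one]
    have hr : g.right = 1 := by
      refine Subgroup.mem_bot.1 (Subgroup.mem_of_pow_mem_of_coprime (H := ⊥) ?_ ?_ hcop)
      · exact (map_pow SemidirectProduct.rightHom g q).symm.trans
          (congrArg SemidirectProduct.right hgq)
      · exact h.pow_prod_of_mem_autB hg
    have hg1 : g = SemidirectProduct.inl g.left := by
      refine SemidirectProduct.ext rfl ?_
      rw [hr]
      rfl
    have hl : g.left = 1 := by
      refine Subgroup.mem_bot.1 (Subgroup.mem_of_pow_mem_of_coprime (H := ⊥) ?_ ?_ hcop)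
      · rw [hg1, ← map_pow, ← map_one SemidirectProduct.inl] at hgq
        exact SemidirectProduct.inl_injective hgq
      · exact h.pow_prod _
    rw [hg1, hl, map_one, orderOf_one] at hord
    exact hq.one_lt.ne hord
  · intro q hq hdvd
    obtain ⟨i, hi, rfl⟩ := h.mem_primeFactors.1 hq
    have := Fact.mk (h.chain.prime i hi)
    have := h.hallH_normal
    obtain ⟨y, hy⟩ := exists_prime_orderOf_dvd_card' (G := Hol N ⧸ CyclicHol.hallH l σ α)
      (p i) hdvd
    obtain ⟨g, rfl⟩ := QuotientGroup.mk_surjective y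
    refine h.not_dvd_exponent hi ?_
    rw [← hy]
    refine orderOf_dvd_of_pow_eq_one ?_
    rw [← QuotientGroup.mk_pow, QuotientGroup.eq_one_iff]
    exact h.pow_mem_hallH g

theorem isHallSubgroup_iff {K : Subgroup (Hol N)} :
    IsHallSubgroup (Nat.card N).primeFactors K ↔ K = CyclicHol.hallH l σ α := by
  refine ⟨fun hK => ?_, fun hK => hK ▸ h.isHallSubgroup_hallH⟩
  have := h.finite_hol
  have hle : K ≤ CyclicHol.hallH l σ α := by
    intro g hg
    -- The order of g involves only primes of the chain, hence is prime to 2(p_l − 1).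
    refine Subgroup.mem_of_pow_mem_of_coprime (a := orderOf g) ?_ (h.pow_mem_hallH g) ?_
    · rw [pow_orderOf_eq_one]
      exact Subgroup.one_mem _
    · refine Nat.coprime_of_dvd fun q hq hdvd hdvd' => ?_
      obtain ⟨i, hi, rfl⟩ := h.mem_primeFactors.1
        (hK.1 q hq (hdvd.trans (Subgroup.orderOf_dvd_natCard K hg)))
      exact h.not_dvd_exponent hi hdvd'
  refine le_antisymm hle (Subgroup.relIndex_eq_one.1 ?_)
  by_contra hne
  obtain ⟨q, hq, hdvd⟩ := Nat.exists_prime_and_dvd hne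
  refine hK.2 q (h.isHallSubgroup_hallH.1 q hq
    (hdvd.trans (Subgroup.relIndex_dvd_card _ _))) (hdvd.trans ?_)
  exact Dvd.intro _ (Subgroup.relIndex_mul_index hle)

theorem card_zpowers_twisted {i : ℕ} (hi : i ∈ Finset.Icc 2 l) (t : ℕ) :
    Nat.card (Subgroup.zpowers (CyclicHol.twisted σ α i t)) = p i := by
  have hi2 := Finset.mem_Icc.1 hi
  have hi1 : i ∈ Finset.Icc 1 l := Finset.mem_Icc.2 ⟨by omega, hi2.2⟩
  have := Fact.mk (h.chain.prime i hi1)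
  rw [Nat.card_zpowers, ← tw_of_two_le σ α hi2.1]
  refine orderOf_eq_prime ?_ ?_
  · rw [← zpow_natCast, h.tw_zpow hi1, zpow_natCast, zpow_natCast, ← pow_mul, mul_comm t, pow_mul,
      h.pre_pow hi1, h.sigma_pow_eq_one hi1, one_pow]
    rfl
  · intro h1
    have hσ : σ i = 1 := congrArg SemidirectProduct.left h1
    have := h.orderOf_sigma hi1
    rw [hσ, orderOf_one] at this
    exact (h.chain.prime i hi1).one_lt.ne this

theorem mem_fullFactor {i : ℕ} (hi : i ∈ Finset.Icc 2 l) {g : Hol N} :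
    g ∈ CyclicHol.fullFactor σ α i ↔
      g.left ∈ Subgroup.zpowers (σ i) ∧ g.right ∈ Subgroup.zpowers (pre α i) := by
  rw [Finset.mem_Icc] at hi
  rw [pre_of_two_le α hi.1]
  constructor
  · intro hg
    induction hg using Subgroup.closure_induction with
    | mem g hg =>
      rcases hg with rfl | rfl
      · exact ⟨Subgroup.mem_zpowers _, Subgroup.one_mem _⟩
      · exact ⟨Subgroup.one_mem _, Subgroup.mem_zpowers _⟩
    | one => exact ⟨Subgroup.one_mem _, Subgroup.one_mem _⟩
    | mul g k _ _ h1 h2 =>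
      exact ⟨(Subgroup.zpowers (σ i)).mul_mem h1.1 (apply_mem_zpowers _ h2.1),
        (Subgroup.zpowers (α (i - 1))).mul_mem h1.2 h2.2⟩
    | inv g _ h1 =>
      exact ⟨apply_mem_zpowers _ ((Subgroup.zpowers (σ i)).inv_mem h1.1),
        (Subgroup.zpowers (α (i - 1))).inv_mem h1.2⟩
  · rintro ⟨h1, h2⟩
    rw [← SemidirectProduct.inl_left_mul_inr_right g]
    obtain ⟨a, ha⟩ := h1
    obtain ⟨b, hb⟩ := h2
    rw [← ha, ← hb]
    simp only [map_zpow]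
    exact (CyclicHol.fullFactor σ α i).mul_mem
      ((CyclicHol.fullFactor σ α i).zpow_mem (Subgroup.subset_closure (Or.inl rfl)) _)
      ((CyclicHol.fullFactor σ α i).zpow_mem (Subgroup.subset_closure (Or.inr rfl)) _)

theorem card_fullFactor {i : ℕ} (hi : i ∈ Finset.Icc 2 l) :
    Nat.card (CyclicHol.fullFactor σ α i) = p i ^ 2 := by
  have hi1 : i ∈ Finset.Icc 1 l := by rw [Finset.mem_Icc] at hi ⊢; omega
  have e : CyclicHol.fullFactor σ α i ≃
      Subgroup.zpowers (σ i) × Subgroup.zpowers (pre α i) :=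
    { toFun := fun g => (⟨g.1.left, ((h.mem_fullFactor hi).1 g.2).1⟩,
        ⟨g.1.right, ((h.mem_fullFactor hi).1 g.2).2⟩)
      invFun := fun y => ⟨⟨y.1, y.2⟩, (h.mem_fullFactor hi).2 ⟨y.1.2, y.2.2⟩⟩
      left_inv := fun _ => rfl
      right_inv := fun _ => rfl }
  rw [Nat.card_congr e, Nat.card_prod, Nat.card_zpowers, Nat.card_zpowers, h.orderOf_sigma hi1,
    h.orderOf_pre hi, sq]

end HolData
end HolData

/-! ### Products of factors inside H -/

section HolData

set_option linter.unusedSectionVars false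

variable {N : Type*} [CommGroup N] [IsCyclic N]

namespace HolData

variable {l : ℕ} {p : ℕ → ℕ} {x s : ℕ} {σ : ℕ → N} {α β : ℕ → MulAut N}
  (h : HolData l p x s σ α β)

include h

theorem eq_one_of_mem_zpowers_pre {i : ℕ} (hi : i ∈ Finset.Icc 1 l) (hi1 : i + 1 ∈ Finset.Icc 1 l)
    {φ : MulAut N} (hφ : φ ∈ Subgroup.zpowers (pre α (i + 1))) (hfix : φ (σ i) = σ i) : φ = 1 := by
  refine h.aut_ext fun j hj => ?_
  rw [MulAut.one_apply]
  rcases eq_or_ne j i with rfl | hne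
  · exact hfix
  · exact h.zpowers_pre_fix hi1 hj (by omega) hφ

theorem pre_mem_zpowers {i : ℕ} (hi : i ∈ Finset.Icc 1 l) {φ : MulAut N}
    (hφ : φ ∈ Subgroup.zpowers (pre α i)) (h1 : φ ≠ 1) : pre α i ∈ Subgroup.zpowers φ := by
  have hp := h.chain.prime i hi
  have hle : Subgroup.zpowers φ ≤ Subgroup.zpowers (pre α i) := Subgroup.zpowers_le.2 hφ
  have := Fact.mk hp
  have := h.finite
  have hord : orderOf φ = p i := orderOf_eq_prime (h.pow_eq_one_of_mem_zpowers_pre hi hφ) h1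
  have heq := Subgroup.eq_of_le_of_card_ge hle (by
    rw [Nat.card_zpowers, Nat.card_zpowers, hord]
    exact Nat.le_of_dvd hp.pos (orderOf_dvd_of_pow_eq_one (h.pre_pow hi)))
  rw [heq]
  exact Subgroup.mem_zpowers _

theorem sigma_mem_zpowers {i : ℕ} (hi : i ∈ Finset.Icc 1 l) {y : N}
    (hy : y ∈ Subgroup.zpowers (σ i)) (h1 : y ≠ 1) : σ i ∈ Subgroup.zpowers y := by
  have := Fact.mk (h.chain.prime i hi)
  have := h.finite
  refine mem_zpowers_of_pow_orderOf_eq_one ?_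
  rw [orderOf_eq_prime ((h.mem_zpowers_iff hi).1 hy) h1, h.sigma_pow_eq_one hi]

theorem ofN_mem_of_mem {M : Subgroup (Hol N)} {i : ℕ} (hi : i ∈ Finset.Icc 1 l) {y : N}
    (hM : Hol.ofN y ∈ M) (hy : y ∈ Subgroup.zpowers (σ i)) (h1 : y ≠ 1) :
    Hol.ofN (σ i) ∈ M :=
  (Subgroup.zpowers_le (H := M.comap (SemidirectProduct.inl : N →* Hol N))).2 hM
    (h.sigma_mem_zpowers hi hy h1)

/-- A commutator of `[σ i, α (i - 1) ^ t]` with an element that moves `σ i`. -/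
theorem ofN_sigma_mem_of_apply_ne {M : Subgroup (Hol N)} {i t : ℕ} (hi : i ∈ Finset.Icc 1 l)
    (ht : tw σ α i t ∈ M) {g : Hol N} (hg : g ∈ M) (hfix : (pre α i ^ t) g.left = g.left)
    (hne : g.right (σ i) ≠ σ i) : Hol.ofN (σ i) ∈ M := by
  -- Automorphisms commute and `pre α i ^ t` fixes `g.left`, so the commutator is a pure translation
  -- in ⟨σ_i⟩, nontrivial because g moves σ_i.
  have hc : Hol.ofN (g.right (σ i) * (σ i)⁻¹) * (tw σ α i t * g) = g * tw σ α i t := by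
    refine SemidirectProduct.ext ?_ ?_
    · change g.right (σ i) * (σ i)⁻¹ * (σ i * (pre α i ^ t) g.left) = g.left * g.right (σ i)
      rw [hfix, mul_assoc, inv_mul_cancel_left, mul_comm]
    · change 1 * (pre α i ^ t * g.right) = g.right * pre α i ^ t
      rw [one_mul, (MulAut.commute_of_isCyclic _ _).eq]
  refine h.ofN_mem_of_mem hi (y := g.right (σ i) * (σ i)⁻¹) ?_ ?_ ?_
  · rw [eq_mul_inv_of_mul_eq hc]
    exact M.mul_mem (M.mul_mem hg ht) (M.inv_mem (M.mul_mem ht hg))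
  · exact (Subgroup.zpowers (σ i)).mul_mem (apply_mem_zpowers _ (Subgroup.mem_zpowers _))
      (Subgroup.inv_mem _ (Subgroup.mem_zpowers _))
  · rwa [Ne, mul_inv_eq_one]

theorem ofN_mem_zpowers_tw {i t : ℕ} (hi : i ∈ Finset.Icc 1 l) {y : N} (hy : y ≠ 1)
    (hys : y ∈ Subgroup.zpowers (σ i))
    (hmem : Hol.ofN y ∈ Subgroup.zpowers (tw σ α i t)) : tw σ α i t = Hol.ofN (σ i) := by
  have hσ := h.ofN_mem_of_mem hi hmem hys hy
  have h1 := h.mem_zpowers_tw_of_left_eq_one hi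
    (Subgroup.mul_mem _ (Subgroup.mem_zpowers (tw σ α i t)) (Subgroup.inv_mem _ hσ)) (by
      rw [← map_inv]
      change σ i * (pre α i ^ t) (σ i)⁻¹ = 1
      rw [map_inv,
        h.zpowers_pre_fix hi hi (by omega) (Subgroup.npow_mem_zpowers _ _), mul_inv_cancel])
  exact mul_inv_eq_one.1 h1

theorem sigma_ne_one {i : ℕ} (hi : i ∈ Finset.Icc 1 l) : σ i ≠ 1 := by
  intro h1
  have := h.orderOf_sigma hi
  rw [h1, orderOf_one] at this
  exact (h.chain.prime i hi).one_lt.ne this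

theorem ofN_sigma_mem_of_inr_pre_mem {M : Subgroup (Hol N)} {i t : ℕ}
    (ht : tw σ α i t ∈ M) (hpre : SemidirectProduct.inr (pre α i) ∈ M) :
    Hol.ofN (σ i) ∈ M := by
  have : (Hol.ofN (σ i) : Hol N) = tw σ α i t * (SemidirectProduct.inr (pre α i) ^ t)⁻¹ := by
    rw [eq_mul_inv_iff_mul_eq, tw, SemidirectProduct.mk_eq_inl_mul_inr, map_pow]
  rw [this]
  exact M.mul_mem ht (M.inv_mem (M.pow_mem hpre _))

theorem factor_cases {A : ℕ → Subgroup (Hol N)} (hA : CyclicHol.IsFactorFamily l p σ α A) {i : ℕ}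
    (hi : i ∈ Finset.Icc 1 l) :
    (∃ t, A i = Subgroup.zpowers (tw σ α i t)) ∨
      i ∈ Finset.Icc 2 l ∧ A i = CyclicHol.fullFactor σ α i := by
  rw [Finset.mem_Icc] at hi
  rcases hi.1.lt_or_eq with h1 | rfl
  · have hi2 : i ∈ Finset.Icc 2 l := Finset.mem_Icc.2 ⟨h1, hi.2⟩
    rcases hA.2 i hi2 with ⟨t, -, ht⟩ | hf
    · exact Or.inl ⟨t, by rw [ht, tw_of_two_le σ α h1]⟩
    · exact Or.inr ⟨hi2, hf⟩
  · exact Or.inl ⟨0, by rw [hA.1, tw_one]⟩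

theorem factor_mem {A : ℕ → Subgroup (Hol N)} (hA : CyclicHol.IsFactorFamily l p σ α A) {i : ℕ}
    (hi : i ∈ Finset.Icc 1 l) {g : Hol N} (hg : g ∈ A i) :
    g.left ∈ Subgroup.zpowers (σ i) ∧ g.right ∈ Subgroup.zpowers (pre α i) := by
  rcases h.factor_cases hA hi with ⟨t, ht⟩ | ⟨hi2, hf⟩
  · rw [ht] at hg
    exact h.tw_zpowers_mem hi hg
  · rw [hf] at hg
    exact (h.mem_fullFactor hi2).1 hg

theorem exists_tw_mem_factor {A : ℕ → Subgroup (Hol N)}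
    (hA : CyclicHol.IsFactorFamily l p σ α A) {i : ℕ} (hi : i ∈ Finset.Icc 1 l) :
    ∃ t, tw σ α i t ∈ A i := by
  rcases h.factor_cases hA hi with ⟨t, ht⟩ | ⟨hi2, hf⟩
  · exact ⟨t, ht ▸ Subgroup.mem_zpowers _⟩
  · refine ⟨0, ?_⟩
    rw [hf, h.mem_fullFactor hi2]
    exact ⟨Subgroup.mem_zpowers _, Subgroup.npow_mem_zpowers _ _⟩

/-- Unique factorisation turns membership in the product set into independent conditions on the
components, the form used below. -/
theorem mem_factor_prod_iff {A : ℕ → Subgroup (Hol N)}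
    (hA : CyclicHol.IsFactorFamily l p σ α A) {g : Hol N} :
    g ∈ ((List.range' 1 l).map fun i => (A i : Set (Hol N))).prod ↔
      g.right ∈ autB l α ∧ ∀ i ∈ Finset.Icc 1 l, comp l p i g ∈ A i := by
  rw [Set.mem_prod_map_range']
  constructor
  · rintro ⟨a, ha, rfl⟩
    have ha' := fun i hi => h.factor_mem hA hi (ha i hi)
    refine ⟨h.prod_right_mem ha', fun i hi => ?_⟩
    rw [h.comp_prod ha' hi]
    exact ha i hi
  · rintro ⟨h1, h2⟩
    exact ⟨fun i => comp l p i g, h2, h.prod_comp h1⟩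

theorem card_eq_prod {A : ℕ → Subgroup (Hol N)} (hA : CyclicHol.IsFactorFamily l p σ α A)
    {M : Subgroup (Hol N)}
    (hM : ∀ g, g ∈ M ↔ g.right ∈ autB l α ∧ ∀ i ∈ Finset.Icc 1 l, comp l p i g ∈ A i) :
    Nat.card M = ∏ i ∈ Finset.Icc 1 l, Nat.card (A i) := by
  have e : Function.Bijective (fun (g : M) (i : Finset.Icc 1 l) =>
      (⟨comp l p i g, ((hM g).1 g.2).2 i i.2⟩ : A i)) := by
    constructor
    · intro g k hgk
      refine Subtype.ext (h.ext_comp ((hM g).1 g.2).1 ((hM k).1 k.2).1 fun i hi => ?_)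
      exact congrArg Subtype.val (congrFun hgk ⟨i, hi⟩)
    · intro a
      have hex : ∀ i, ∃ b : Hol N, ∀ hi : i ∈ Finset.Icc 1 l, b = a ⟨i, hi⟩ := by
        intro i
        by_cases hi : i ∈ Finset.Icc 1 l
        · exact ⟨a ⟨i, hi⟩, fun _ => rfl⟩
        · exact ⟨1, fun hi' => absurd hi' hi⟩
      choose b hb using hex
      have hbA : ∀ i ∈ Finset.Icc 1 l, b i ∈ A i := fun i hi => by
        rw [hb i hi]
        exact (a ⟨i, hi⟩).2
      have hb' := fun i hi => h.factor_mem hA hi (hbA i hi)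
      refine ⟨⟨((List.range' 1 l).map b).prod, (hM _).2 ⟨h.prod_right_mem hb', fun i hi => ?_⟩⟩, ?_⟩
      · rw [h.comp_prod hb' hi]
        exact hbA i hi
      · funext i
        refine Subtype.ext ?_
        exact (h.comp_prod hb' i.2).trans (hb i i.2)
  rw [Nat.card_congr (Equiv.ofBijective _ e), Nat.card_pi]
  exact Finset.prod_coe_sort _ fun i => Nat.card (A i)

/-- The cardinality clause is automatic, since taking components is a bijection from M onto the
product of the A_i. -/
theorem isInternalProduct_iff {A : ℕ → Subgroup (Hol N)}
    (hA : CyclicHol.IsFactorFamily l p σ α A) {M : Subgroup (Hol N)} :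
    IsInternalProduct l A M ↔
      ∀ g, g ∈ M ↔ g.right ∈ autB l α ∧ ∀ i ∈ Finset.Icc 1 l, comp l p i g ∈ A i := by
  constructor
  · rintro ⟨hM, -⟩ g
    rw [← h.mem_factor_prod_iff hA, ← hM, SetLike.mem_coe]
  · intro hM
    refine ⟨?_, h.card_eq_prod hA hM⟩
    ext g
    rw [h.mem_factor_prod_iff hA, SetLike.mem_coe, hM]

theorem factor_le {A : ℕ → Subgroup (Hol N)} (hA : CyclicHol.IsFactorFamily l p σ α A)
    {M : Subgroup (Hol N)}
    (hM : ∀ g, g ∈ M ↔ g.right ∈ autB l α ∧ ∀ i ∈ Finset.Icc 1 l, comp l p i g ∈ A i)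
    {i : ℕ} (hi : i ∈ Finset.Icc 1 l) : A i ≤ M := by
  intro g hg
  obtain ⟨hl, hr⟩ := h.factor_mem hA hi hg
  refine (hM g).2 ⟨Subgroup.zpowers_le.2 (h.pre_mem_autB hi) hr, fun j hj => ?_⟩
  rw [comp, h.zpowers_pow_projExp hj hi hl, h.zpowers_pre_pow_projExp hj hi hr]
  split_ifs with hji
  · subst hji
    exact hg
  · exact (A j).one_mem

/-- Adjacent factors of a product subgroup. -/
theorem adjacent_factors {A : ℕ → Subgroup (Hol N)} (hA : CyclicHol.IsFactorFamily l p σ α A)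
    {M : Subgroup (Hol N)}
    (hM : ∀ g, g ∈ M ↔ g.right ∈ autB l α ∧ ∀ i ∈ Finset.Icc 1 l, comp l p i g ∈ A i)
    {i : ℕ} (hi2 : 2 ≤ i) (hil : i < l) :
    A i = Subgroup.zpowers (Hol.ofN (σ i)) ∨ A i = CyclicHol.fullFactor σ α i ∨
      A (i + 1) = Subgroup.zpowers (Hol.ofN (σ (i + 1))) := by
  have hi : i ∈ Finset.Icc 1 l := Finset.mem_Icc.2 ⟨by omega, by omega⟩
  have hi1 : i + 1 ∈ Finset.Icc 1 l := Finset.mem_Icc.2 ⟨by omega, by omega⟩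
  rcases h.factor_cases hA hi with ⟨t, ht⟩ | ⟨-, hf⟩
  swap
  · exact Or.inr (Or.inl hf)
  by_cases hAi : A (i + 1) = Subgroup.zpowers (Hol.ofN (σ (i + 1)))
  · exact Or.inr (Or.inr hAi)
  left
  -- Such a g has a nontrivial power of α_i as automorphism part, so it moves σ_i. Its commutator
  -- with the generator of A_i puts σ_i into M, hence into A_i, which forces the twist to vanish.
  obtain ⟨g, hg, hg1⟩ : ∃ g ∈ A (i + 1), g.right ≠ 1 := by
    rcases h.factor_cases hA hi1 with ⟨u, hu⟩ | ⟨hi1', hf⟩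
    · refine ⟨tw σ α (i + 1) u, hu ▸ Subgroup.mem_zpowers _, fun h1 => hAi ?_⟩
      rw [hu]
      congr 1
      exact SemidirectProduct.ext rfl h1
    · refine ⟨SemidirectProduct.inr (pre α (i + 1)), ?_, fun h1 => ?_⟩
      · rw [hf, h.mem_fullFactor hi1']
        exact ⟨Subgroup.one_mem _, Subgroup.mem_zpowers _⟩
      · have h1 : pre α (i + 1) = 1 := h1
        have := h.orderOf_pre hi1'
        rw [h1, orderOf_one] at this
        exact (h.chain.prime _ hi1).one_lt.ne this
  obtain ⟨hgl, hgr⟩ := h.factor_mem hA hi1 hg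
  have htw : tw σ α i t ∈ A i := ht ▸ Subgroup.mem_zpowers _
  have hσ := h.ofN_sigma_mem_of_apply_ne hi (h.factor_le hA hM hi htw)
    (h.factor_le hA hM hi1 hg)
    (apply_eq_self_of_mem_zpowers
      (h.zpowers_pre_fix hi hi1 (by omega) (Subgroup.npow_mem_zpowers _ _)) hgl)
    (fun hfix => hg1 (h.eq_one_of_mem_zpowers_pre hi hi1 hgr hfix))
  have hcomp := ((hM _).1 hσ).2 i hi
  have : comp l p i (Hol.ofN (σ i)) = Hol.ofN (σ i) := by
    refine SemidirectProduct.ext ?_ (one_pow _)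
    exact h.chain.pow_projExp_of_pow_eq_one hi (h.sigma_pow_eq_one hi)
  rw [this, ht] at hcomp
  rw [ht, h.ofN_mem_zpowers_tw hi (h.sigma_ne_one hi) (Subgroup.mem_zpowers _) hcomp]

theorem mem_zpowers_ofN {i : ℕ} {g : Hol N} :
    g ∈ Subgroup.zpowers (Hol.ofN (σ i)) ↔ g.left ∈ Subgroup.zpowers (σ i) ∧ g.right = 1 := by
  constructor
  · rintro ⟨k, rfl⟩
    simp only [← map_zpow]
    exact ⟨Subgroup.zpow_mem_zpowers _ _, rfl⟩
  · rintro ⟨⟨k, hk⟩, h2⟩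
    refine ⟨k, ?_⟩
    simp only at hk ⊢
    rw [← map_zpow, hk]
    exact SemidirectProduct.ext rfl h2.symm

/-- The i-th component is multiplicative at (g, k) when g fixes σ_i, which holds if i = l or A_{i+1}
= ⟨σ_{i+1}⟩. Otherwise A_i is ⟨σ_i⟩ or the full factor, and membership depends at most on the
automorphism coordinate, which is always multiplicative. -/
theorem exists_subgroup_of_adjacent {A : ℕ → Subgroup (Hol N)}
    (hA : CyclicHol.IsFactorFamily l p σ α A)
    (hadj : ∀ i, 2 ≤ i → i < l →
      A i = Subgroup.zpowers (Hol.ofN (σ i)) ∨ A i = CyclicHol.fullFactor σ α i ∨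
        A (i + 1) = Subgroup.zpowers (Hol.ofN (σ (i + 1)))) :
    ∃ M : Subgroup (Hol N),
      ∀ g, g ∈ M ↔ g.right ∈ autB l α ∧ ∀ i ∈ Finset.Icc 1 l, comp l p i g ∈ A i := by
  have hone : (1 : Hol N).right ∈ autB l α ∧ ∀ i ∈ Finset.Icc 1 l, comp l p i (1 : Hol N) ∈ A i := by
    refine ⟨Subgroup.one_mem _, fun i _ => ?_⟩
    have : comp l p i (1 : Hol N) = 1 := SemidirectProduct.ext (one_pow _) (one_pow _)
    rw [this]
    exact (A i).one_mem
  have hmul : ∀ g k : Hol N,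
      (g.right ∈ autB l α ∧ ∀ i ∈ Finset.Icc 1 l, comp l p i g ∈ A i) →
      (k.right ∈ autB l α ∧ ∀ i ∈ Finset.Icc 1 l, comp l p i k ∈ A i) →
      (g * k).right ∈ autB l α ∧ ∀ i ∈ Finset.Icc 1 l, comp l p i (g * k) ∈ A i := by
    rintro g k ⟨hg, hgA⟩ ⟨hk, hkA⟩
    refine ⟨Subgroup.mul_mem _ hg hk, fun i hi => ?_⟩
    have hi' := Finset.mem_Icc.1 hi
    have hright : (comp l p i (g * k)).right = (comp l p i g).right * (comp l p i k).right :=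
      (MulAut.commute_of_isCyclic _ _).mul_pow _
    have hcases : g.right (σ i) = σ i ∨ A i = Subgroup.zpowers (Hol.ofN (σ i)) ∨
        i ∈ Finset.Icc 2 l ∧ A i = CyclicHol.fullFactor σ α i := by
      rcases hi'.1.lt_or_eq with h1 | rfl
      · rcases hi'.2.lt_or_eq with h2 | rfl
        · rcases hadj i h1 h2 with h3 | h3 | h3
          · exact Or.inr (Or.inl h3)
          · exact Or.inr (Or.inr ⟨Finset.mem_Icc.2 ⟨h1, hi'.2⟩, h3⟩)
          · refine Or.inl (h.autB_apply_eq_self hg hi fun _ => ?_)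
            have := hgA (i + 1) (Finset.mem_Icc.2 ⟨by omega, h2⟩)
            rw [h3, h.mem_zpowers_ofN] at this
            exact this.2
        · exact Or.inl (h.autB_apply_last hg)
      · exact Or.inr (Or.inl hA.1)
    rcases hcases with h1 | h1 | ⟨hi2, h1⟩
    · have : comp l p i (g * k) = comp l p i g * comp l p i k := by
        refine SemidirectProduct.ext ?_ hright
        change (g.left * g.right k.left) ^ projExp l p i = g.left ^ projExp l p i *
          (g.right ^ projExp l p i) (k.left ^ projExp l p i)
        rw [mul_pow, ← map_pow, apply_eq_self_of_mem_zpowers h1 (h.pow_projExp_mem_zpowers hi _),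
          apply_eq_self_of_mem_zpowers
            (h.zpowers_pre_fix hi hi (by omega) (h.pow_projExp_mem_zpowers_pre hi g.right))
            (h.pow_projExp_mem_zpowers hi _)]
      rw [this]
      exact (A i).mul_mem (hgA i hi) (hkA i hi)
    · have hgi := hgA i hi
      have hki := hkA i hi
      rw [h1, h.mem_zpowers_ofN] at hgi hki ⊢
      exact ⟨(h.comp_mem _ i hi).1, by rw [hright, hgi.2, hki.2, one_mul]⟩
    · rw [h1, h.mem_fullFactor hi2]
      exact h.comp_mem _ i hi
  refine ⟨{ carrier := {g | g.right ∈ autB l α ∧ ∀ i ∈ Finset.Icc 1 l, comp l p i g ∈ A i}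
            one_mem' := hone
            mul_mem' := fun {g k} hg hk => hmul g k hg hk
            inv_mem' := fun {g} hg => ?_ }, fun _ => Iff.rfl⟩
  have := h.finite_hol
  have hpow : ∀ m : ℕ, (g ^ m).right ∈ autB l α ∧
      ∀ i ∈ Finset.Icc 1 l, comp l p i (g ^ m) ∈ A i := by
    intro m
    induction m with
    | zero => rw [pow_zero]; exact hone
    | succ m ih => rw [pow_succ]; exact hmul _ _ ih hg
  have hinv : g⁻¹ = g ^ (orderOf g - 1) := inv_eq_of_mul_eq_one_right
    (by rw [mul_pow_sub_one (orderOf_pos g).ne', pow_orderOf_eq_one])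
  rw [hinv]
  exact hpow _

theorem isPretransitive_iff_of_le {M : Subgroup (Hol N)} (hle : M ≤ CyclicHol.hallH l σ α) :
    MulAction.IsPretransitive M N ↔
      ∃ A : ℕ → Subgroup (Hol N),
        CyclicHol.IsFactorFamily l p σ α A ∧ IsInternalProduct l A M := by
  classical
  constructor
  · intro hM
    have hex : ∀ i, ∃ t, i ∈ Finset.Icc 1 l → t < p i ∧ tw σ α i t ∈ M := by
      intro i
      by_cases hi : i ∈ Finset.Icc 1 l
      · obtain ⟨t, ht⟩ := h.exists_tw_mem (M := M) hi
        exact ⟨t, fun _ => ht⟩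
      · exact ⟨0, fun hi' => absurd hi' hi⟩
    choose t ht using hex
    -- The i-th factor is full exactly when M contains α_{i−1}; otherwise the twisted element
    -- provided by transitivity generates it.
    let A : ℕ → Subgroup (Hol N) := fun i =>
      if 2 ≤ i ∧ SemidirectProduct.inr (pre α i) ∈ M then CyclicHol.fullFactor σ α i
      else Subgroup.zpowers (tw σ α i (t i))
    have hAdef : ∀ i, A i = if 2 ≤ i ∧ SemidirectProduct.inr (pre α i) ∈ M
        then CyclicHol.fullFactor σ α i else Subgroup.zpowers (tw σ α i (t i)) := fun _ => rfl
    have hA : CyclicHol.IsFactorFamily l p σ α A := by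
      constructor
      · rw [hAdef, if_neg (by omega), tw_one]
      · intro i hi
        rw [Finset.mem_Icc] at hi
        rw [hAdef]
        split_ifs with hc
        · exact Or.inr rfl
        · refine Or.inl ⟨t i, ?_, by rw [tw_of_two_le σ α hi.1]⟩
          have := (ht i (Finset.mem_Icc.2 ⟨by omega, hi.2⟩)).1
          omega
    have hAM : ∀ i ∈ Finset.Icc 1 l, A i ≤ M := by
      intro i hi
      rw [hAdef]
      split_ifs with hc
      · refine (Subgroup.closure_le _).2 ?_
        rintro _ (rfl | rfl)
        · exact h.ofN_sigma_mem_of_inr_pre_mem (ht i hi).2 hc.2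
        · rw [← pre_of_two_le α hc.1]
          exact hc.2
      · exact Subgroup.zpowers_le.2 (ht i hi).2
    refine ⟨A, hA, (h.isInternalProduct_iff hA).2 fun g => ⟨fun hg => ?_, fun hg => ?_⟩⟩
    · have hgB := h.mem_hallH.1 (hle hg)
      refine ⟨hgB, fun i hi => ?_⟩
      rw [hAdef]
      split_ifs with hc
      · exact (h.mem_fullFactor (Finset.mem_Icc.2 ⟨hc.1, (Finset.mem_Icc.1 hi).2⟩)).2
          (h.comp_mem g i hi)
      -- Compare g with k ∈ M over the same point, all of whose components are twisted powers. Then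
      -- k⁻¹g is an automorphism in M whose projection to ⟨α_{i−1}⟩ must be trivial, since by
      -- primality it would otherwise generate α_{i−1}.
      · obtain ⟨k, hk, hkl, hkB, hkc⟩ := h.exists_mem_left_eq (fun i hi => (ht i hi).2) g.left
        have hquot : k⁻¹ * g = SemidirectProduct.inr (k.right⁻¹ * g.right) := by
          refine SemidirectProduct.ext ?_ rfl
          change k.right⁻¹ k.left⁻¹ * k.right⁻¹ g.left = 1
          rw [hkl, ← map_mul, inv_mul_cancel, map_one]
        have hmem : (k.right⁻¹ * g.right) ∈
            M.comap (SemidirectProduct.inr : MulAut N →* Hol N) := by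
          rw [Subgroup.mem_comap, ← hquot]
          exact M.mul_mem (M.inv_mem hk) hg
        have hpow := Subgroup.pow_mem _ hmem (projExp l p i)
        have hone : (k.right⁻¹ * g.right) ^ projExp l p i = 1 := by
          by_contra hne
          have hpre := Subgroup.zpowers_le.2 hpow
            (h.pre_mem_zpowers hi (h.pow_projExp_mem_zpowers_pre hi _) hne)
          have hi' := Finset.mem_Icc.1 hi
          rcases hi'.1.lt_or_eq with h1 | rfl
          · exact hc ⟨h1, hpre⟩
          · refine hne ?_
            have := h.pow_projExp_mem_zpowers_pre hi (k.right⁻¹ * g.right)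
            rw [pre, if_pos rfl, Subgroup.zpowers_one_eq_bot, Subgroup.mem_bot] at this
            exact this
        have : comp l p i g = comp l p i k := by
          refine SemidirectProduct.ext (by rw [comp, comp, hkl]) ?_
          rw [(MulAut.commute_of_isCyclic _ _).mul_pow, inv_pow, inv_mul_eq_one] at hone
          exact hone.symm
        rw [this]
        exact hkc i hi
    · rw [← h.prod_comp hg.1]
      exact Subgroup.list_prod_map_range'_mem fun i hi => hAM i hi (hg.2 i hi)
  · rintro ⟨A, hA, hM⟩
    rw [h.isInternalProduct_iff hA] at hM
    have hex : ∀ i, ∃ t, i ∈ Finset.Icc 1 l → tw σ α i t ∈ A i := by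
      intro i
      by_cases hi : i ∈ Finset.Icc 1 l
      · obtain ⟨t, ht⟩ := h.exists_tw_mem_factor hA hi
        exact ⟨t, fun _ => ht⟩
      · exact ⟨0, fun hi' => absurd hi' hi⟩
    choose t ht using hex
    exact h.isPretransitive_of_tw_mem fun i hi => h.factor_le hA hM hi (ht i hi)

end HolData
end HolData

/-! ### Transitive subgroups of the holomorph as semidirect products -/

section HolData

set_option linter.unusedSectionVars false

variable {N : Type*} [CommGroup N] [IsCyclic N]

theorem Hol.inr_conj (φ : MulAut N) (g : Hol N) :
    SemidirectProduct.inr φ * g * (SemidirectProduct.inr φ)⁻¹ = ⟨φ g.left, g.right⟩ := by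
  refine SemidirectProduct.ext ?_ ?_
  · rw [← map_inv]
    change 1 * φ g.left * (φ * g.right) 1 = φ g.left
    rw [map_one, mul_one, one_mul]
  · rw [← map_inv]
    change φ * g.right * φ⁻¹ = g.right
    rw [(MulAut.commute_of_isCyclic φ g.right).eq, mul_inv_cancel_right]

namespace HolData

variable {l : ℕ} {p : ℕ → ℕ} {x s : ℕ} {σ : ℕ → N} {α β : ℕ → MulAut N}
  (h : HolData l p x s σ α β)

include h

theorem autI_apply {I : Finset ℕ} {φ : MulAut N} (hφ : φ ∈ CyclicHol.autI l α β I) {i : ℕ}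
    (hi : i ∈ Finset.Icc 1 l) (hiI : i ∈ I) : φ (σ i) = σ i := by
  have hle : CyclicHol.autI l α β I ≤ (multiplier (σ i)).ker := by
    refine (Subgroup.closure_le _).2 ?_
    rintro _ (⟨j, hj, hjI, -, rfl⟩ | ⟨j, hj, hjI, rfl⟩)
    · rw [SetLike.mem_coe, MonoidHom.mem_ker, multiplier_eq_one_iff]
      exact h.gen.α_fix j hj i hi fun hij => hjI (hij ▸ hiI)
    · rw [SetLike.mem_coe, MonoidHom.mem_ker, multiplier_eq_one_iff]
      exact h.gen.β_fix j hj i hi fun hij => hjI (hij ▸ hiI)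
  exact (multiplier_eq_one_iff _ _).1 (hle hφ)

theorem tw_mem_J {I : Finset ℕ} {t : ℕ → ℕ} (hI : CyclicHol.IsIndexData l p I t) {i : ℕ}
    (hi : i ∈ Finset.Icc 1 l) :
    tw σ α i (if i ∈ I then t i else 0) ∈ CyclicHol.J l σ α I t := by
  split_ifs with hiI
  · rw [tw_of_two_le σ α (Finset.mem_Icc.1 (hI.1 hiI)).1]
    exact Subgroup.subset_closure (Or.inr ⟨i, hiI, rfl⟩)
  · rw [tw_zero]
    exact Subgroup.subset_closure (Or.inl ⟨i, Finset.mem_sdiff.2 ⟨hi, hiI⟩, rfl⟩)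

/-- As I has no consecutive elements, the cyclic factors satisfy the adjacency condition, so J lies
in a product subgroup each of whose factors is a graph over ⟨σ_i⟩. Hence J meets `Aut N` trivially.
-/
theorem eq_one_of_mem_J {I : Finset ℕ} {t : ℕ → ℕ} (hI : CyclicHol.IsIndexData l p I t)
    {g : Hol N} (hg : g ∈ CyclicHol.J l σ α I t) (hl : g.left = 1) : g = 1 := by
  have hA : CyclicHol.IsFactorFamily l p σ α
      fun i => Subgroup.zpowers (tw σ α i (if i ∈ I then t i else 0)) := by
    refine ⟨by simp only [tw_one], fun i hi => Or.inl ⟨if i ∈ I then t i else 0, ?_, ?_⟩⟩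
    · split_ifs with hiI
      · exact (hI.2.2 i hiI).2
      · exact Nat.zero_le _
    · simp only [tw_of_two_le σ α (Finset.mem_Icc.1 hi).1]
  obtain ⟨M, hM⟩ := h.exists_subgroup_of_adjacent hA (by
    intro i _ _
    by_cases hiI : i ∈ I
    · right; right
      rw [if_neg (hI.2.1 i hiI), tw_zero]
    · left
      rw [if_neg hiI, tw_zero])
  have hle : CyclicHol.J l σ α I t ≤ M := by
    refine (Subgroup.closure_le _).2 ?_
    rintro _ (⟨i, hi, rfl⟩ | ⟨i, hi, rfl⟩)
    · rw [Finset.mem_sdiff] at hi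
      refine h.factor_le hA hM hi.1 ?_
      rw [if_neg hi.2, tw_zero]
      exact Subgroup.mem_zpowers _
    · have hi2 := Finset.mem_Icc.1 (hI.1 hi)
      refine h.factor_le hA hM (Finset.mem_Icc.2 ⟨by omega, hi2.2⟩) ?_
      rw [if_pos hi, ← tw_of_two_le σ α hi2.1]
      exact Subgroup.mem_zpowers _
  obtain ⟨hB, hc⟩ := (hM g).1 (hle hg)
  refine h.ext_comp hB (Subgroup.one_mem _) fun i hi => ?_
  rw [h.mem_zpowers_tw_of_left_eq_one hi (hc i hi) (by rw [comp, hl, one_pow])]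
  exact SemidirectProduct.ext (one_pow _).symm (one_pow _).symm

/-- Conjugation by an automorphism acts on the left coordinate only. It preserves every ⟨σ_j⟩, and
A_I fixes σ_i for i ∈ I, so the generators of J go into J. -/
theorem isInternalSemidirect_sup {I : Finset ℕ} {t : ℕ → ℕ} {A : Subgroup (MulAut N)}
    (hI : CyclicHol.IsIndexData l p I t) (hA : A ≤ CyclicHol.autI l α β I) :
    IsInternalSemidirect (CyclicHol.J l σ α I t ⊔ Hol.autSubgroup A) (CyclicHol.J l σ α I t)
      (Hol.autSubgroup A) := by
  refine ⟨le_sup_left, le_sup_right, ?_, ?_, rfl⟩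
  · refine Subgroup.normal_subgroupOf_of_le_normalizer (sup_le Subgroup.le_normalizer ?_)
    refine Subgroup.le_normalizer_closure_iff.2 ?_
    rintro _ ⟨φ, hφ, rfl⟩ g hg
    rw [Hol.inr_conj]
    rcases hg with ⟨j, hj, rfl⟩ | ⟨i, hi, rfl⟩
    · have hle : Subgroup.zpowers (σ j) ≤ (CyclicHol.J l σ α I t).comap
          (SemidirectProduct.inl : N →* Hol N) :=
        Subgroup.zpowers_le.2 (Subgroup.subset_closure (Or.inl ⟨j, hj, rfl⟩))
      exact hle (apply_mem_zpowers φ (Subgroup.mem_zpowers (σ j)))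
    · have hi2 := Finset.mem_Icc.1 (hI.1 hi)
      have hfix := h.autI_apply (hA hφ) (Finset.mem_Icc.2 ⟨by omega, hi2.2⟩) hi
      refine Subgroup.subset_closure (Or.inr ⟨i, hi, ?_⟩)
      exact SemidirectProduct.ext hfix rfl
  · rw [eq_bot_iff]
    rintro g ⟨hgJ, φ, -, rfl⟩
    exact h.eq_one_of_mem_J hI hgJ rfl

/-- The two orders are coprime with product p_i − 1, so the powers of α_iβ_i realise every
multiplier on σ_i. -/
theorem orderOf_alpha_mul_beta {i : ℕ} (hi : i ∈ Finset.Icc 1 l) :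
    orderOf (α i * β i) = p i - 1 := by
  have hi' := Finset.mem_Icc.1 hi
  rcases hi'.2.lt_or_eq with hlt | rfl
  · have hi1 : i + 1 ∈ Finset.Icc 1 l := Finset.mem_Icc.2 ⟨by omega, hlt⟩
    have ha := h.gen.orderOf_α i hi'.1 hlt
    have hb := h.gen.orderOf_β i hi'.1 hlt
    rw [(MulAut.commute_of_isCyclic _ _).orderOf_mul_eq_mul_orderOf_of_coprime, ha, hb,
      h.chain.step i hi'.1 hlt, Nat.add_sub_cancel, mul_comm]
    rw [ha, hb]
    exact (h.chain.odd _ hi1).coprime_two_right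
  · rw [(MulAut.commute_of_isCyclic _ _).orderOf_mul_eq_mul_orderOf_of_coprime,
      h.gen.orderOf_α_last, h.gen.orderOf_β_last, h.last, Nat.add_sub_cancel, mul_comm]
    rw [h.gen.orderOf_α_last, h.gen.orderOf_β_last]
    exact (h.odd.coprime_two_right).pow_right _

theorem pow_apply_eq_self_of_fix {γ : MulAut N} {i : ℕ}
    (hγ : ∀ j ∈ Finset.Icc 1 l, j ≠ i → γ (σ j) = σ j) (k : ℕ) :
    ∀ j ∈ Finset.Icc 1 l, j ≠ i → (γ ^ k) (σ j) = σ j := fun j hj hji => by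
  rw [← multiplier_eq_one_iff, map_pow, (multiplier_eq_one_iff _ _).2 (hγ j hj hji), one_pow]

/-- Write the exponent as 2c. On σ_i the square of φ is killed by c and, as p_i − 1 = 2p_{i+1}, by
p_{i+1}; these are coprime. So without an α_i-part the multiplier of φ is ±1, which β_i realises. -/
theorem sq_apply_eq_self {φ : MulAut N} {i : ℕ} (hi : 1 ≤ i) (hil : i < l)
    (hφ : φ ^ projExp l p (i + 1) = 1) : (φ ^ 2) (σ i) = σ i := by
  have hi1 : i ∈ Finset.Icc 1 l := Finset.mem_Icc.2 ⟨hi, hil.le⟩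
  have hi2 : i + 1 ∈ Finset.Icc 1 l := Finset.mem_Icc.2 ⟨by omega, hil⟩
  obtain ⟨c, hc⟩ := h.chain.two_dvd_projExp hi2
  have hcop : c.Coprime (p (i + 1)) := by
    have h1 := (h.chain.projExp_modEq_one hi2).gcd_eq
    rw [Nat.gcd_one_left] at h1
    exact Nat.Coprime.coprime_dvd_left (Dvd.intro_left 2 hc.symm) h1
  rw [← multiplier_eq_one_iff, ← MonoidHom.mem_ker]
  refine Subgroup.mem_of_pow_mem_of_coprime ?_ ?_ hcop
  · rw [← pow_mul, ← hc, hφ]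
    exact Subgroup.one_mem _
  · rw [← pow_mul, MonoidHom.mem_ker, multiplier_eq_one_iff]
    refine h.apply_pow_sub_one hi1 φ ?_
    rw [h.chain.step i hi hil, Nat.add_sub_cancel]

theorem exists_isInternalSemidirect (M : Subgroup (Hol N)) [MulAction.IsPretransitive M N] :
    ∃ (I : Finset ℕ) (t : ℕ → ℕ) (A : Subgroup (MulAut N)),
      CyclicHol.IsIndexData l p I t ∧ A ≤ CyclicHol.autI l α β I ∧
        IsInternalSemidirect M (CyclicHol.J l σ α I t) (Hol.autSubgroup A) := by
  classical
  have hex : ∀ i, ∃ t, i ∈ Finset.Icc 1 l → t < p i ∧ tw σ α i t ∈ M := by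
    intro i
    by_cases hi : i ∈ Finset.Icc 1 l
    · obtain ⟨t, ht⟩ := h.exists_tw_mem (M := M) hi
      exact ⟨t, fun _ => ht⟩
    · exact ⟨0, fun hi' => absurd hi' hi⟩
  choose t ht using hex
  -- The index 1 can be left out: there the twist is trivial, so σ_1 always lies in M.
  let I := (Finset.Icc 2 l).filter fun i => Hol.ofN (σ i) ∉ M
  have hI1 : ∀ i ∈ I, i ∈ Finset.Icc 1 l ∧ 2 ≤ i ∧ Hol.ofN (σ i) ∉ M := by
    intro i hi
    obtain ⟨hi, hiM⟩ := Finset.mem_filter.1 hi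
    rw [Finset.mem_Icc] at hi
    exact ⟨Finset.mem_Icc.2 ⟨by omega, hi.2⟩, hi.1, hiM⟩
  have hnI : ∀ i ∈ Finset.Icc 1 l, i ∉ I → Hol.ofN (σ i) ∈ M := by
    intro i hi hiI
    have hi' := Finset.mem_Icc.1 hi
    rcases hi'.1.lt_or_eq with h1 | rfl
    · by_contra hM
      exact hiI (Finset.mem_filter.2 ⟨Finset.mem_Icc.2 ⟨h1, hi'.2⟩, hM⟩)
    · have := (ht 1 hi).2
      rwa [tw_one] at this
  have hpre : ∀ i ∈ I, pre α i ^ t i ≠ 1 := by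
    intro i hi h1
    obtain ⟨hi1, -, hiM⟩ := hI1 i hi
    have := (ht i hi1).2
    rw [tw, h1] at this
    exact hiM this
  have hI : CyclicHol.IsIndexData l p I t := by
    refine ⟨Finset.filter_subset _ _, fun i hi hi' => ?_, fun i hi => ⟨?_, ?_⟩⟩
    · obtain ⟨hi1, -, hiM⟩ := hI1 i hi
      obtain ⟨hi1', -, -⟩ := hI1 _ hi'
      -- With i and i + 1 both in I, the twisted element at i + 1 moves σ_i, and the commutator
      -- would put σ_i into M.
      refine hiM (h.ofN_sigma_mem_of_apply_ne hi1 (ht i hi1).2 (ht _ hi1').2 ?_ fun hfix => ?_)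
      · exact h.zpowers_pre_fix hi1 hi1' (by omega) (Subgroup.npow_mem_zpowers _ _)
      · exact hpre _ hi' (h.eq_one_of_mem_zpowers_pre hi1 hi1' (Subgroup.npow_mem_zpowers _ _) hfix)
    · refine Nat.one_le_iff_ne_zero.2 fun h0 => hpre i hi ?_
      rw [h0, pow_zero]
    · have := (ht i (hI1 i hi).1).1
      omega
  let A := M.comap (SemidirectProduct.inr : MulAut N →* Hol N)
  have hA : A ≤ CyclicHol.autI l α β I := by
    intro φ hφ
    refine h.mem_of_local fun i hi => ?_
    have hi' := Finset.mem_Icc.1 hi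
    -- Local action of φ ∈ M at σ_i: trivial if i ∈ I (commutator); a power of β_i if i + 1 ∈ I,
    -- since α_i ∈ M would give σ_{i+1} ∈ M; otherwise any multiplier, realised by α_iβ_i.
    by_cases hiI : i ∈ I
    · refine ⟨1, Subgroup.one_mem _, ?_, fun _ _ _ => rfl⟩
      by_contra hne
      exact (hI1 i hiI).2.2 (h.ofN_sigma_mem_of_apply_ne hi (ht i hi).2 hφ (map_one _)
        (fun hfix => hne hfix.symm))
    have hβ : β i ∈ CyclicHol.autI l α β I :=
      Subgroup.subset_closure (Or.inr ⟨i, hi, hiI, rfl⟩)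
    by_cases hiI' : i + 1 ∈ I
    · obtain ⟨hi1, -, hiM⟩ := hI1 _ hiI'
      have hil : i < l := (Finset.mem_Icc.1 hi1).2
      have hone : φ ^ projExp l p (i + 1) = 1 := by
        by_contra hne
        refine hiM (h.ofN_sigma_mem_of_inr_pre_mem (ht _ hi1).2 ?_)
        exact Subgroup.zpowers_le.2 (A.pow_mem hφ _)
          (h.pre_mem_zpowers hi1 (h.pow_projExp_mem_zpowers_pre hi1 _) hne)
      have hfix := fun j hj hji => h.gen.β_fix i hi j hj hji
      obtain ⟨k, hk⟩ := h.exists_pow_apply_eq' hi hfix (h.gen.orderOf_β i hi'.1 hil) two_pos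
        (h.sq_apply_eq_self hi'.1 hil hone)
      exact ⟨β i ^ k, Subgroup.pow_mem _ hβ _, hk, h.pow_apply_eq_self_of_fix hfix k⟩
    · have hα : α i ∈ CyclicHol.autI l α β I :=
        Subgroup.subset_closure (Or.inl ⟨i, hi, hiI, hiI', rfl⟩)
      have hfix : ∀ j ∈ Finset.Icc 1 l, j ≠ i → (α i * β i) (σ j) = σ j := fun j hj hji => by
        rw [MulAut.mul_apply, h.gen.β_fix i hi j hj hji, h.gen.α_fix i hi j hj hji]
      obtain ⟨k, hk⟩ := h.exists_pow_apply_eq' hi hfix (h.orderOf_alpha_mul_beta hi)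
        (Nat.pos_of_ne_zero (h.chain.sub_one_ne_zero hi)) (h.apply_pow_sub_one hi φ dvd_rfl)
      exact ⟨_, Subgroup.pow_mem _ (Subgroup.mul_mem _ hα hβ) k, hk,
        h.pow_apply_eq_self_of_fix hfix k⟩
  refine ⟨I, t, A, hI, hA, ?_⟩
  have hJM : CyclicHol.J l σ α I t ≤ M := by
    refine (Subgroup.closure_le _).2 ?_
    rintro _ (⟨i, hi, rfl⟩ | ⟨i, hi, rfl⟩)
    · rw [Finset.mem_sdiff] at hi
      exact hnI i hi.1 hi.2
    · obtain ⟨hi1, hi2, -⟩ := hI1 i hi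
      rw [← tw_of_two_le σ α hi2]
      exact (ht i hi1).2
  have hsup : CyclicHol.J l σ α I t ⊔ Hol.autSubgroup A = M := by
    refine le_antisymm (sup_le hJM (Subgroup.map_comap_le _ _)) fun g hg => ?_
    -- J has an element over every point of N, so each g ∈ M differs from an element of J by an
    -- automorphism in M.
    obtain ⟨k, hk, hkl, -⟩ := h.exists_mem_left_eq (fun i hi => h.tw_mem_J hI hi) g.left
    have hquot : k⁻¹ * g = SemidirectProduct.inr (k.right⁻¹ * g.right) := by
      refine SemidirectProduct.ext ?_ rfl
      change k.right⁻¹ k.left⁻¹ * k.right⁻¹ g.left = 1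
      rw [hkl, ← map_mul, inv_mul_cancel, map_one]
    rw [← mul_inv_cancel_left k g]
    refine Subgroup.mul_mem _ (Subgroup.mem_sup_left hk) (Subgroup.mem_sup_right ?_)
    rw [hquot]
    refine Subgroup.mem_map_of_mem _ ?_
    rw [Subgroup.mem_comap, ← hquot]
    exact M.mul_mem (M.inv_mem (hJM hk)) hg
  have := h.isInternalSemidirect_sup hI hA
  rwa [hsup] at this

theorem isPretransitive_sup {I : Finset ℕ} {t : ℕ → ℕ} (A : Subgroup (MulAut N))
    (hI : CyclicHol.IsIndexData l p I t) :
    MulAction.IsPretransitive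
      (CyclicHol.J l σ α I t ⊔ Hol.autSubgroup A : Subgroup (Hol N)) N :=
  h.isPretransitive_of_tw_mem fun _ hi => Subgroup.mem_sup_left (h.tw_mem_J hI hi)

theorem le_hallH {A : ℕ → Subgroup (Hol N)} {M : Subgroup (Hol N)}
    (hM : ∀ g, g ∈ M ↔ g.right ∈ autB l α ∧ ∀ i ∈ Finset.Icc 1 l, comp l p i g ∈ A i) :
    M ≤ CyclicHol.hallH l σ α := fun g hg => h.mem_hallH.2 ((hM g).1 hg).1

theorem eq_of_adjacent_prime {M : Subgroup (Hol N)} {A : ℕ → Subgroup (Hol N)}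
    (hA : CyclicHol.IsFactorFamily l p σ α A) (hM : IsInternalProduct l A M) {i : ℕ}
    (hi : 2 ≤ i) (hil : i < l) (hprime : (Nat.card (A i)).Prime) :
    A i = Subgroup.zpowers (Hol.ofN (σ i)) ∨
      A (i + 1) = Subgroup.zpowers (Hol.ofN (σ (i + 1))) := by
  rcases h.adjacent_factors hA ((h.isInternalProduct_iff hA).1 hM) hi hil with h1 | h1 | h1
  · exact Or.inl h1
  · rw [h1, h.card_fullFactor (Finset.mem_Icc.2 ⟨hi, hil.le⟩)] at hprime
    exact absurd hprime (Nat.Prime.not_prime_pow le_rfl)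
  · exact Or.inr h1

theorem exists_isInternalProduct_iff {A : ℕ → Subgroup (Hol N)}
    (hA : CyclicHol.IsFactorFamily l p σ α A) :
    (∃ M : Subgroup (Hol N), M ≤ CyclicHol.hallH l σ α ∧ IsInternalProduct l A M) ↔
      ∀ i, 2 ≤ i → i < l →
        A i = Subgroup.zpowers (Hol.ofN (σ i)) ∨ A i = CyclicHol.fullFactor σ α i ∨
          A (i + 1) = Subgroup.zpowers (Hol.ofN (σ (i + 1))) := by
  constructor
  · rintro ⟨M, -, hM⟩ i hi hil
    exact h.adjacent_factors hA ((h.isInternalProduct_iff hA).1 hM) hi hil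
  · intro hadj
    obtain ⟨M, hM⟩ := h.exists_subgroup_of_adjacent hA hadj
    exact ⟨M, h.le_hallH hM, (h.isInternalProduct_iff hA).2 hM⟩

end HolData
end HolData

theorem mainTheorem3 {N : Type*} [Group N] [IsCyclic N] (l : ℕ) (p : ℕ → ℕ)
    (hp : IsCunninghamChain l p) (hN : Nat.card N = ∏ i ∈ Finset.Icc 1 l, p i)
    (x s : ℕ) (hxs : p l = 2 ^ x * s + 1) (hs : Odd s)
    (σ : ℕ → N) (α β : ℕ → MulAut N) (hgen : CyclicHol.IsGeneratorChoice l p x s σ α β) :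
    -- the transitive subgroups of `Hol N`
    (∀ M : Subgroup (Hol N), MulAction.IsPretransitive M N →
      ∃ (I : Finset ℕ) (t : ℕ → ℕ) (A : Subgroup (MulAut N)),
        CyclicHol.IsIndexData l p I t ∧ A ≤ CyclicHol.autI l α β I ∧
          IsInternalSemidirect M (CyclicHol.J l σ α I t) (Hol.autSubgroup A)) ∧
    (∀ (I : Finset ℕ) (t : ℕ → ℕ) (A : Subgroup (MulAut N)),
      CyclicHol.IsIndexData l p I t → A ≤ CyclicHol.autI l α β I →
        ∃ M : Subgroup (Hol N),
          IsInternalSemidirect M (CyclicHol.J l σ α I t) (Hol.autSubgroup A) ∧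
            MulAction.IsPretransitive M N) ∧
    -- `H` is the unique Hall subgroup for the primes dividing `|N|`, and it is normal
    ((CyclicHol.hallH l σ α).Normal ∧
      ∀ K : Subgroup (Hol N),
        IsHallSubgroup (Nat.card N).primeFactors K ↔ K = CyclicHol.hallH l σ α) ∧
    -- the orders of the possible factors
    (∀ i ∈ Finset.Icc 2 l,
      (∀ t ≤ p i - 1, Nat.card (Subgroup.zpowers (CyclicHol.twisted σ α i t)) = p i) ∧
        Nat.card (CyclicHol.fullFactor σ α i) = p i ^ 2) ∧
    -- the transitive subgroups of `H`
    (∀ M : Subgroup (Hol N), M ≤ CyclicHol.hallH l σ α →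
      (MulAction.IsPretransitive M N ↔
        ∃ A : ℕ → Subgroup (Hol N),
          CyclicHol.IsFactorFamily l p σ α A ∧ IsInternalProduct l A M)) ∧
    -- two adjacent factors of prime order are not both twisted
    (∀ (M : Subgroup (Hol N)) (A : ℕ → Subgroup (Hol N)),
      CyclicHol.IsFactorFamily l p σ α A → IsInternalProduct l A M →
        ∀ i, 2 ≤ i → i < l → (Nat.card (A i)).Prime → (Nat.card (A (i + 1))).Prime →
          A i = Subgroup.zpowers (Hol.ofN (σ i)) ∨
            A (i + 1) = Subgroup.zpowers (Hol.ofN (σ (i + 1)))) ∧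
    -- which families of factors do occur
    (∀ A : ℕ → Subgroup (Hol N), CyclicHol.IsFactorFamily l p σ α A →
      ((∃ M : Subgroup (Hol N), M ≤ CyclicHol.hallH l σ α ∧ IsInternalProduct l A M) ↔
        ∀ i, 2 ≤ i → i < l →
          A i = Subgroup.zpowers (Hol.ofN (σ i)) ∨ A i = CyclicHol.fullFactor σ α i ∨
            A (i + 1) = Subgroup.zpowers (Hol.ofN (σ (i + 1))))) := by
  let _ : CommGroup N := IsCyclic.commGroup
  have h : HolData l p x s σ α β := ⟨hp, hN, hxs, hs, hgen⟩
  refine ⟨fun M hM => h.exists_isInternalSemidirect M, fun I t A hI hA => ?_,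
    ⟨h.hallH_normal, fun K => h.isHallSubgroup_iff⟩, fun i hi => ?_,
    fun M hM => h.isPretransitive_iff_of_le hM, fun M A hA hM i hi hil hprime _ => ?_,
    fun A hA => h.exists_isInternalProduct_iff hA⟩
  · exact ⟨_, h.isInternalSemidirect_sup hI hA, h.isPretransitive_sup A hI⟩
  · exact ⟨fun t _ => h.card_zpowers_twisted hi t, h.card_fullFactor hi⟩
  · exact h.eq_of_adjacent_prime hA hM hi hil hprime
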